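/- Consider $\mathbb H^1=\mathbb R^3$ with the left-invariant fields $X_1=\partial_x-\frac y2\partial_t$, $X_2=\partial_y+\frac x2\partial_t$, $T=\partial_t$ and the Riemannian metric for which they are orthonormal. Let $S\subset\mathbb H^1$ be an oriented $C^3$ surface: near each of its points $S$ is the zero set of a $C^3$ function $\varphi$ without critical points, and $S$ carries a normal field $N$ with $N=\nabla\varphi=pX_1+q X_2+\omega T$ on $S$, where $p=X_1\varphi$, $q=X_2\varphi$, $\omega=T\varphi$. Assume that the characteristic locus $\Sigma(S)=\{g\in S: T_gS=\mathrm{span}(X_1(g),X_2(g))\}$ is empty. Put $W=\sqrt{p^2+q^2}$, $\bar p=p/W$, $\bar q=q/W$, $\bar\omega=\omega/W$, $\nu_H=Y=\bar pX_1+\bar qX_2$, $Z=\bar qX_1-\bar pX_2$, and $$\mathcal A=(\bar pT\bar q-\bar qT\bar p)+\bar\omega(\bar qY\bar p-\bar pY\bar q)+\bar\omega^2,$$ where the derivatives are taken of the extensions of $\bar p,\bar q$ off $S$ given by a local defining function $\varphi$ (the value of $\mathcal A$ on $S$ does not depend on $\varphi$). On a surface let $d\sigma_H=\frac{W}{|N|}\,d\sigma$,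 with $d\sigma$ the Riemannian surface measure, and let $P_H(E)=\int_E d\sigma_H$. Let $h\in C^2_0(S)$, that is, $h$ is the restriction to $S$ of a $C^2$ function on $\mathbb R^3$ and vanishes on $S$ outside a compact set $K\subset S$. For $E\subset S$ and $\lambda\in\mathbb R$ let $E^\lambda=\{g+\lambda h(g)\nu_H(g): g\in E\}$. Let $E$ be a Borel set with $K\subset E\subset S$ and $P_H(E)<\infty$ (for instance $E=S$, if $P_H(S)<\infty$). Then $P_H(E^\lambda)$, computed on the surface $S^\lambda$, is finite for all $\lambda$ close to $0$ and is twice differentiable in $\lambda$ at $0$, the function $(Zh)^2+h^2(2\mathcal A-\bar\omega^2)$ is $\sigma_H$-integrable on $S$, and $$\frac{d^2}{d\lambda^2}\Big|_{\lambda=0}P_H(E^\lambda)=\int_S\Big\{(Zh)^2+h^2\big(2\mathcal A-\bar\omega^2\big)\Big\}\,d\sigma_H=\int_S\Big\{(Zh)^2+h^2\big[2(\bar pT\bar q-\bar qT\bar p)+2\bar\omega(\bar qY\bar p-\bar pY\bar q)+\bar\omega^2\big]\Big\}\,d\sigma_H .$$ -/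

import Mathlib

open MeasureTheory Filter Topology Set

noncomputable section

/-- The underlying space `ℝ³` of the first Heisenberg group, with points `g = (x, y, t)` and the
group law `(x,y,t) ∘ (x',y',t') = (x + x', y + y', t + t' + (x y' - x' y) / 2)`. -/
abbrev Heis : Type := ℝ × ℝ × ℝ

namespace Heis

/-- The left-invariant field `X₁ = ∂_x - (y/2) ∂_t`. -/
def X₁ (g : Heis) : Heis := (1, 0, -(g.2.1 / 2))

/-- The left-invariant field `X₂ = ∂_y + (x/2) ∂_t`. -/
def X₂ (g : Heis) : Heis := (0, 1, g.1 / 2)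

/-- The left-invariant field `T = ∂_t`. -/
def T (_g : Heis) : Heis := (0, 0, 1)

/-- The derivative `V f` of a function `f` along a vector field `V`. -/
def along (V : Heis → Heis) (f : Heis → ℝ) (g : Heis) : ℝ := fderiv ℝ f g (V g)

/-- The horizontal plane `H_g`, spanned by `X₁` and `X₂`. -/
def horizontal (g : Heis) : Submodule ℝ Heis := Submodule.span ℝ {X₁ g, X₂ g}

/-- The components of a vector `v` at `g` in the frame `X₁, X₂, T`:
`v = (coords g v 0) X₁ + (coords g v 1) X₂ + (coords g v 2) T`.
The left-invariant Riemannian metric is the one for which this frame is orthonormal, so it is the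
standard inner product of these components. -/
def coords (g v : Heis) : Fin 3 → ℝ :=
  ![v.1, v.2.1, v.2.2 + (g.2.1 * v.1 - g.1 * v.2.1) / 2]

/-- The Riemannian gradient `(X₁ f, X₂ f, T f)`, in the frame `X₁, X₂, T`. -/
def grad (f : Heis → ℝ) (g : Heis) : Fin 3 → ℝ :=
  ![along X₁ f g, along X₂ f g, along T f g]

/-- The Riemannian length of the vector with frame components `n`. -/
def len (n : Fin 3 → ℝ) : ℝ := √(n 0 ^ 2 + n 1 ^ 2 + n 2 ^ 2)

/-- The length `W` of the horizontal part of the vector with frame components `n`. -/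
def hlen (n : Fin 3 → ℝ) : ℝ := √(n 0 ^ 2 + n 1 ^ 2)

/-! ### Surface measure and `H`-perimeter measure -/

/-- A local parametrization of (a piece of) `M ⊆ ℝ³`: an injective `C¹` immersion of an open
subset of the plane, with values in `M`. -/
structure Chart (M : Set Heis) where
  /-- the parameter domain -/
  dom : Set (ℝ × ℝ)
  /-- the parametrization -/
  toFun : ℝ × ℝ → Heis
  isOpen_dom : IsOpen dom
  contDiffOn : ContDiffOn ℝ 1 toFun dom
  injOn : InjOn toFun dom
  immersion : ∀ u ∈ dom, Function.Injective (fderiv ℝ toFun u)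
  mapsTo : MapsTo toFun dom M

/-- The normal `ψ_u × ψ_v` of a parametrization `ψ`, the vector product being the one of the
left-invariant Riemannian metric. Its Riemannian length is the Riemannian area element. -/
def Chart.normal {M : Set Heis} (c : Chart M) (u : ℝ × ℝ) : Fin 3 → ℝ :=
  crossProduct (coords (c.toFun u) (fderiv ℝ c.toFun u (1, 0)))
    (coords (c.toFun u) (fderiv ℝ c.toFun u (0, 1)))

/-- The `H`-perimeter measure `dσ_H = (W / |N|) dσ` of the part of `M` parametrized by `c`. Here
`dσ = |N| du dv` is the Riemannian surface measure, `N` the normal of the parametrization, and `W`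
the length of the horizontal part of `N`. -/
def Chart.hPerimeter {M : Set Heis} (c : Chart M) : Measure Heis :=
  Measure.map c.toFun ((volume.restrict c.dom).withDensity fun u =>
    ENNReal.ofReal (hlen (c.normal u) / len (c.normal u) * len (c.normal u)))

/-- The `H`-perimeter measure `σ_H` of a surface `M`. On an embedded surface the measures of
the local parametrizations agree on overlaps, that is, each of them is the restriction of one
measure on `M` to the image of the parametrization; their supremum is this measure. -/
def hPerimeter (M : Set Heis) : Measure Heis := ⨆ c : Chart M, c.hPerimeter

/-! ### The frame `Z, Y, T` attached to a normal field

In this section `n` is a (non-unit) normal field `p X₁ + q X₂ + ω T`, given by its components. -/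

/-- `p̄ = p / W`. -/
def pbar (n : Heis → Fin 3 → ℝ) (g : Heis) : ℝ := n g 0 / hlen (n g)

/-- `q̄ = q / W`. -/
def qbar (n : Heis → Fin 3 → ℝ) (g : Heis) : ℝ := n g 1 / hlen (n g)

/-- `ω̄ = ω / W`. -/
def ombar (n : Heis → Fin 3 → ℝ) (g : Heis) : ℝ := n g 2 / hlen (n g)

/-- The horizontal Gauss map `Y = ν_H = p̄ X₁ + q̄ X₂`. -/
def Y (n : Heis → Fin 3 → ℝ) (g : Heis) : Heis := pbar n g • X₁ g + qbar n g • X₂ g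

/-- The horizontal tangent field `Z = ν_H^⊥ = q̄ X₁ - p̄ X₂`. -/
def Z (n : Heis → Fin 3 → ℝ) (g : Heis) : Heis := qbar n g • X₁ g - pbar n g • X₂ g

/-- `p̄ T q̄ - q̄ T p̄`. -/
def twistT (n : Heis → Fin 3 → ℝ) (g : Heis) : ℝ :=
  pbar n g * along T (qbar n) g - qbar n g * along T (pbar n) g

/-- `q̄ Y p̄ - p̄ Y q̄`. -/
def twistY (n : Heis → Fin 3 → ℝ) (g : Heis) : ℝ :=
  qbar n g * along (Y n) (pbar n) g - pbar n g * along (Y n) (qbar n) g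

/-- `𝒜 = (p̄ T q̄ - q̄ T p̄) + ω̄ (q̄ Y p̄ - p̄ Y q̄) + ω̄²`. -/
def calA (n : Heis → Fin 3 → ℝ) (g : Heis) : ℝ :=
  twistT n g + ombar n g * twistY n g + ombar n g ^ 2

/-! ### Oriented surfaces -/

/-- `φ` is a `C^k` defining function on the open set `O` of the surface `S` with normal field
`N`. -/
structure IsDefining (k : WithTop ℕ∞) (S : Set Heis) (N : Heis → Fin 3 → ℝ) (O : Set Heis)
    (φ : Heis → ℝ) : Prop where
  isOpen : IsOpen O
  contDiffOn : ContDiffOn ℝ k φ O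
  grad_ne_zero : ∀ g ∈ O, grad φ g ≠ 0
  inter_eq : S ∩ O = {g ∈ O | φ g = 0}
  normal_eq : ∀ g ∈ S ∩ O, N g = grad φ g

/-- An oriented `C^k` surface: a subset of `ℝ³` with a (non-unit) normal field `N`, which near
each of its points is the zero set of a `C^k` function `φ` without critical points such that
`N = ∇φ`. Only the values of `N` on the surface matter. -/
structure OrientedSurface (k : WithTop ℕ∞) where
  /-- the set of points of the surface -/
  carrier : Set Heis
  /-- the components `p, q, ω` of the normal field in the frame `X₁, X₂, T` -/
  N : Heis → Fin 3 → ℝ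
  exists_defining : ∀ g ∈ carrier, ∃ O φ, g ∈ O ∧ IsDefining k carrier N O φ

namespace OrientedSurface

variable {k : WithTop ℕ∞}

open Classical in
/-- A defining function of the surface near the point `g` of the surface. -/
def defining (S : OrientedSurface k) (g : Heis) : Heis → ℝ :=
  if hg : g ∈ S.carrier then (S.exists_defining g hg).choose_spec.choose else 0

/-- The extension `∇φ` of the normal field to a neighbourhood of the point `g`, by a local
defining function `φ`. -/
def normalNear (S : OrientedSurface k) (g : Heis) : Heis → Fin 3 → ℝ := grad (S.defining g)

/-- The tangent plane at a point of the surface. -/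
def tangent (S : OrientedSurface k) (g : Heis) : Submodule ℝ Heis :=
  LinearMap.ker (fderiv ℝ (S.defining g) g).toLinearMap

/-- The characteristic locus `Σ(S)`: the points at which the tangent plane is horizontal. -/
def charLocus (S : OrientedSurface k) : Set Heis :=
  {g ∈ S.carrier | S.tangent g = horizontal g}

/-- The function `𝒜` on the surface. The derivatives of `p̄` and `q̄` are those of the extensions
of `p̄` and `q̄` by a local defining function. They enter only through the tangential operator
`T - ω̄ Y`, so the value does not depend on the choice of the defining function. -/
def calA (S : OrientedSurface k) (g : Heis) : ℝ := Heis.calA (S.normalNear g) g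

/-- The integrand `(Zh)² + h² (2 𝒜 - ω̄²)`. -/
def integrand (S : OrientedSurface k) (h : Heis → ℝ) (g : Heis) : ℝ :=
  along (Z S.N) h g ^ 2 + h g ^ 2 * (2 * S.calA g - ombar S.N g ^ 2)

/-- The integrand `(Zh)² + h² [2 (p̄ T q̄ - q̄ T p̄) + 2 ω̄ (q̄ Y p̄ - p̄ Y q̄) + ω̄²]`. -/
def integrand' (S : OrientedSurface k) (h : Heis → ℝ) (g : Heis) : ℝ :=
  along (Z S.N) h g ^ 2 + h g ^ 2 * (2 * twistT (S.normalNear g) g +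
    2 * ombar S.N g * twistY (S.normalNear g) g + ombar S.N g ^ 2)

/-- The deformation `g ↦ g + s h(g) ν_H(g)` of the surface. -/
def deform (S : OrientedSurface k) (h : Heis → ℝ) (s : ℝ) (g : Heis) : Heis :=
  g + (s * h g) • Y S.N g

/-- The `H`-perimeter `P_H(E^s)` of the part `E^s = {g + s h(g) ν_H(g) | g ∈ E}` of the deformed
surface `S^s = {g + s h(g) ν_H(g) | g ∈ S}`. -/
def deformedPerimeter (S : OrientedSurface k) (h : Heis → ℝ) (E : Set Heis) (s : ℝ) : ENNReal :=
  hPerimeter (S.deform h s '' S.carrier) (S.deform h s '' E)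

end OrientedSurface

/-- The real function `V` is differentiable near `x`, and its derivative is differentiable at `x`
with derivative `c`. -/
def HasSecondDerivAt (V : ℝ → ℝ) (c x : ℝ) : Prop :=
  ∃ V' : ℝ → ℝ, (∀ᶠ s in 𝓝 x, HasDerivAt V (V' s) s) ∧ HasDerivAt V' c x

end Heis

end

/-!
The field `h ν_H` on `S` extends to a compactly supported `C¹` field `a X₁ + b X₂` on `ℝ³`. For
small `s` the displacement by `s (a X₁ + b X₂)` is a diffeomorphism of `ℝ³` that deforms `S`. It
transports the frame `Z`, `T - ω̄ Y` of the tangent planes, and the horizontal part of the vector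
product of the transported fields is a cubic polynomial `x₀ + s x₁ + s² x₂ + s³ x₃` with
`|x₀| = 1`. Its length is the Jacobian of the deformation for the measures `σ_H`. Off the support
of `h` this Jacobian is `1`, so `P_H(E^s)` is a constant plus the integral of
`|x₀ + s x₁ + s² x₂ + s³ x₃|` over a compact set, whose second derivative at `0` is the integral of
`|x₁|² + 2 ⟨x₀, x₂⟩ - ⟨x₀, x₁⟩²`. This density differs from `(Zh)² + h² (2 𝒜 - ω̄²)` by the exact
form `d(h (a dx + b dy))`, evaluated on the frame, and the integral of the latter vanishes by
Stokes' theorem.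
-/

open scoped Manifold ContDiff RealInnerProductSpace

noncomputable section

namespace Heis

/-! ### Frames -/

section Plane

variable (L : ℝ × ℝ →L[ℝ] ℝ × ℝ)

theorem det_prod_real :
    L.det = (L (1, 0)).1 * (L (0, 1)).2 - (L (0, 1)).1 * (L (1, 0)).2 := by
  rw [ContinuousLinearMap.det, ← LinearMap.det_toMatrix (Module.Basis.finTwoProd ℝ),
    Matrix.det_fin_two]
  simp [LinearMap.toMatrix_apply]

theorem mul_sub_mul_comp_eq_det_mul (α β : ℝ × ℝ →L[ℝ] ℝ) :
    α (L (1, 0)) * β (L (0, 1)) - α (L (0, 1)) * β (L (1, 0)) =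
      L.det * (α (1, 0) * β (0, 1) - α (0, 1) * β (1, 0)) := by
  have expand (γ : ℝ × ℝ →L[ℝ] ℝ) (w : ℝ × ℝ) : γ w = w.1 * γ (1, 0) + w.2 * γ (0, 1) := by
    rw [← smul_eq_mul, ← smul_eq_mul, ← map_smul, ← map_smul, ← map_add]
    simp
  rw [det_prod_real, expand α (L _), expand β (L _), expand α (L (0, 1)), expand β (L (1, 0))]
  ring

theorem crossProduct_comp_eq_det_smul (B : ℝ × ℝ →L[ℝ] Fin 3 → ℝ) :
    crossProduct (B (L (1, 0))) (B (L (0, 1))) =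
      L.det • crossProduct (B (1, 0)) (B (0, 1)) := by
  have minor (i j : Fin 3) :=
    mul_sub_mul_comp_eq_det_mul L ((ContinuousLinearMap.proj i).comp B)
      ((ContinuousLinearMap.proj j).comp B)
  simp only [ContinuousLinearMap.comp_apply, ContinuousLinearMap.proj_apply] at minor
  ext i
  fin_cases i
  · simpa [cross_apply, mul_comm] using minor 1 2
  · simpa [cross_apply, mul_comm] using minor 2 0
  · simpa [cross_apply, mul_comm] using minor 0 1

end Plane

/-- The components in the frame `X₁, X₂, T`, as a continuous linear map. -/
def coordsL (g : Heis) : Heis →L[ℝ] Fin 3 → ℝ :=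
  LinearMap.toContinuousLinearMap
    { toFun := coords g
      map_add' := fun v w => by ext i; fin_cases i <;> simp [coords]; ring
      map_smul' := fun r v => by ext i; fin_cases i <;> simp [coords]; ring }

theorem coordsL_apply (g v : Heis) : coordsL g v = coords g v := rfl

theorem frame_expansion (g v : Heis) :
    v = coords g v 0 • X₁ g + coords g v 1 • X₂ g + coords g v 2 • T g := by
  ext <;> simp [coords, X₁, X₂, T]; ring

theorem mem_horizontal_iff {g v : Heis} : v ∈ horizontal g ↔ coords g v 2 = 0 := by
  rw [horizontal, Submodule.mem_span_pair]
  constructor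
  · rintro ⟨r, s, rfl⟩
    simp [coords, X₁, X₂]; ring
  · intro hv
    refine ⟨coords g v 0, coords g v 1, ?_⟩
    conv_rhs => rw [frame_expansion g v, hv, zero_smul, add_zero]

theorem fderiv_eq_dotProduct_grad (f : Heis → ℝ) (g v : Heis) :
    fderiv ℝ f g v = coords g v ⬝ᵥ grad f g := by
  conv_lhs => rw [frame_expansion g v]
  simp [grad, along, dotProduct, Fin.sum_univ_three]

theorem contDiff_X₁ (k : ℕ∞ω) : ContDiff ℝ k X₁ := by unfold X₁; fun_prop
theorem contDiff_X₂ (k : ℕ∞ω) : ContDiff ℝ k X₂ := by unfold X₂; fun_prop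
theorem contDiff_T (k : ℕ∞ω) : ContDiff ℝ k T := by unfold T; fun_prop

theorem contDiffOn_grad {m k : ℕ∞ω} {f : Heis → ℝ} {O : Set Heis} (hO : IsOpen O)
    (hf : ContDiffOn ℝ k f O) (hmk : m + 1 ≤ k) : ContDiffOn ℝ m (grad f) O := by
  have hdf : ContDiffOn ℝ m (fderiv ℝ f) O := hf.fderiv_of_isOpen hO hmk
  rw [contDiffOn_pi]
  intro i
  fin_cases i
  · exact hdf.clm_apply (contDiff_X₁ m).contDiffOn
  · exact hdf.clm_apply (contDiff_X₂ m).contDiffOn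
  · exact hdf.clm_apply (contDiff_T m).contDiffOn

theorem hlen_sq (n : Fin 3 → ℝ) : hlen n ^ 2 = n 0 ^ 2 + n 1 ^ 2 := by
  rw [hlen, Real.sq_sqrt (by positivity)]

theorem hlen_eq_zero_iff {n : Fin 3 → ℝ} : hlen n = 0 ↔ n 0 = 0 ∧ n 1 = 0 := by
  rw [hlen, Real.sqrt_eq_zero (by positivity), add_eq_zero_iff_of_nonneg (by positivity)
    (by positivity), sq_eq_zero_iff, sq_eq_zero_iff]

theorem hlen_smul (r : ℝ) (n : Fin 3 → ℝ) : hlen (r • n) = |r| * hlen n := by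
  simp only [hlen, Pi.smul_apply, smul_eq_mul, mul_pow]
  rw [← mul_add, Real.sqrt_mul (sq_nonneg r), Real.sqrt_sq_eq_abs]

theorem continuous_hlen : Continuous hlen := by unfold hlen; fun_prop

theorem hlen_div_len_mul_len (n : Fin 3 → ℝ) : hlen n / len n * len n = hlen n := by
  refine div_mul_cancel_of_imp fun hl => ?_
  rw [len, Real.sqrt_eq_zero (by positivity)] at hl
  rw [hlen, Real.sqrt_eq_zero (by positivity)]
  exact le_antisymm (by linarith [sq_nonneg (n 2)]) (by positivity)

section Frame

variable {n : Heis → Fin 3 → ℝ} {g : Heis}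

theorem pbar_sq_add_qbar_sq (hW : hlen (n g) ≠ 0) : pbar n g ^ 2 + qbar n g ^ 2 = 1 := by
  rw [pbar, qbar, div_pow, div_pow, ← add_div, ← hlen_sq]
  exact div_self (pow_ne_zero 2 hW)

theorem contDiffAt_hlen_comp {k : ℕ∞ω} (hn : ContDiffAt ℝ k n g) (hW : hlen (n g) ≠ 0) :
    ContDiffAt ℝ k (fun x => hlen (n x)) g := by
  rw [contDiffAt_pi] at hn
  refine (((hn 0).pow 2).add ((hn 1).pow 2)).sqrt fun h0 => hW ?_
  rw [hlen, h0, Real.sqrt_zero]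

theorem contDiffAt_pbar {k : ℕ∞ω} (hn : ContDiffAt ℝ k n g) (hW : hlen (n g) ≠ 0) :
    ContDiffAt ℝ k (pbar n) g :=
  (contDiffAt_pi.1 hn 0).div (contDiffAt_hlen_comp hn hW) hW

theorem contDiffAt_qbar {k : ℕ∞ω} (hn : ContDiffAt ℝ k n g) (hW : hlen (n g) ≠ 0) :
    ContDiffAt ℝ k (qbar n) g :=
  (contDiffAt_pi.1 hn 1).div (contDiffAt_hlen_comp hn hW) hW

variable (n g)

/-- The transversal tangent field `T - ω̄ Y`, which together with `Z` spans the tangent planes of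
a non-characteristic surface with normal field `n`. -/
def tanT : Heis := T g - ombar n g • Y n g

@[simp] theorem Z_fst : (Z n g).1 = qbar n g := by simp [Z, X₁, X₂]

@[simp] theorem Z_snd_fst : (Z n g).2.1 = -pbar n g := by simp [Z, X₁, X₂]

@[simp] theorem Z_snd_snd : (Z n g).2.2 = -(g.2.1 / 2 * qbar n g) - g.1 / 2 * pbar n g := by
  simp [Z, X₁, X₂, mul_comm]

@[simp] theorem tanT_fst : (tanT n g).1 = -(ombar n g * pbar n g) := by
  simp [tanT, Y, T, X₁, X₂]

@[simp] theorem tanT_snd_fst : (tanT n g).2.1 = -(ombar n g * qbar n g) := by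
  simp [tanT, Y, T, X₁, X₂]

@[simp] theorem tanT_snd_snd : (tanT n g).2.2 =
    1 - ombar n g * (g.1 / 2 * qbar n g - g.2.1 / 2 * pbar n g) := by
  simp [tanT, Y, T, X₁, X₂, mul_comm, neg_add_eq_sub]

theorem coords_Z : coords g (Z n g) = ![qbar n g, -pbar n g, 0] := by
  simp only [coords, Z_fst, Z_snd_fst, Z_snd_snd]
  congr 3; ring

theorem coords_tanT :
    coords g (tanT n g) = ![-(ombar n g * pbar n g), -(ombar n g * qbar n g), 1] := by
  simp only [coords, tanT_fst, tanT_snd_fst, tanT_snd_snd]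
  congr 3; ring

/-- The linear map `(r, s) ↦ r Z + s (T - ω̄ Y)`, onto the plane orthogonal to `n`. -/
def tangentFrame : ℝ × ℝ →L[ℝ] Heis :=
  (ContinuousLinearMap.toSpanSingleton ℝ (Z n g)).coprod
    (ContinuousLinearMap.toSpanSingleton ℝ (tanT n g))

/-- The components in the frame `Z, T - ω̄ Y` of the vectors orthogonal to `n`. -/
def tangentCoords : Heis →L[ℝ] ℝ × ℝ :=
  (ContinuousLinearMap.prod
    (qbar n g • ContinuousLinearMap.proj 0 - pbar n g • ContinuousLinearMap.proj 1)
    (ContinuousLinearMap.proj 2)).comp (coordsL g)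

theorem tangentFrame_apply (w : ℝ × ℝ) :
    tangentFrame n g w = w.1 • Z n g + w.2 • tanT n g := by simp [tangentFrame]

theorem tangentCoords_apply (v : Heis) :
    tangentCoords n g v = (qbar n g * coords g v 0 - pbar n g * coords g v 1, coords g v 2) := by
  simp [tangentCoords, coordsL_apply]

variable {n g}

theorem hlen_crossProduct_frame (hW : hlen (n g) ≠ 0) :
    hlen (crossProduct (coords g (Z n g)) (coords g (tanT n g))) = 1 := by
  rw [coords_Z, coords_tanT, hlen, cross_apply, Real.sqrt_eq_one]
  simpa [add_comm] using pbar_sq_add_qbar_sq hW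

theorem tangentFrame_tangentCoords (hW : hlen (n g) ≠ 0) {v : Heis}
    (hv : coords g v ⬝ᵥ n g = 0) : tangentFrame n g (tangentCoords n g v) = v := by
  have unit := pbar_sq_add_qbar_sq hW
  have orth : coords g v 0 * pbar n g + coords g v 1 * qbar n g + coords g v 2 * ombar n g = 0 := by
    simp only [dotProduct, Fin.sum_univ_three] at hv
    rw [pbar, qbar, ombar]
    field_simp
    linarith
  have e2 : v.2.2 = coords g v 2 - (g.2.1 * coords g v 0 - g.1 * coords g v 1) / 2 := by
    simp [coords]
  rw [tangentFrame_apply, tangentCoords_apply]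
  refine Prod.ext ?_ (Prod.ext ?_ ?_)
  · simp only [Prod.fst_add, Prod.smul_fst, smul_eq_mul, Z_fst, tanT_fst]
    change _ = coords g v 0
    linear_combination coords g v 0 * unit - pbar n g * orth
  · simp only [Prod.fst_add, Prod.smul_fst, Prod.snd_add, Prod.smul_snd, smul_eq_mul, Z_snd_fst,
      tanT_snd_fst]
    change _ = coords g v 1
    linear_combination coords g v 1 * unit - qbar n g * orth
  · simp only [Prod.snd_add, Prod.smul_snd, smul_eq_mul, Z_snd_snd, tanT_snd_snd]
    rw [e2]
    linear_combination (g.1 / 2 * coords g v 1 - g.2.1 / 2 * coords g v 0) * unit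
      + (g.2.1 / 2 * pbar n g - g.1 / 2 * qbar n g) * orth

end Frame

/-! ### Surfaces and their tangent planes -/

namespace IsDefining

variable {k m : ℕ∞ω} {M O : Set Heis} {N : Heis → Fin 3 → ℝ} {φ : Heis → ℝ}

theorem of_le (h : IsDefining k M N O φ) (hmk : m ≤ k) : IsDefining m M N O φ :=
  { h with contDiffOn := h.contDiffOn.of_le hmk }

theorem contDiffAt (h : IsDefining k M N O φ) {g : Heis} (hg : g ∈ O) : ContDiffAt ℝ k φ g :=
  h.contDiffOn.contDiffAt (h.isOpen.mem_nhds hg)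

theorem mem_iff (h : IsDefining k M N O φ) {g : Heis} (hg : g ∈ O) : g ∈ M ↔ φ g = 0 := by
  simpa [hg] using Set.ext_iff.1 h.inter_eq g

theorem fderiv_ne_zero (h : IsDefining k M N O φ) {g : Heis} (hg : g ∈ O) :
    fderiv ℝ φ g ≠ 0 := by
  intro h0
  refine h.grad_ne_zero g hg ?_
  ext i
  fin_cases i <;> simp [grad, along, h0]

end IsDefining

namespace Chart

variable {M : Set Heis} (c : Chart M) {u : ℝ × ℝ}

theorem differentiableAt (hu : u ∈ c.dom) : DifferentiableAt ℝ c.toFun u :=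
  (c.contDiffOn.contDiffAt (c.isOpen_dom.mem_nhds hu)).differentiableAt one_ne_zero

theorem continuousAt (hu : u ∈ c.dom) : ContinuousAt c.toFun u :=
  (c.differentiableAt hu).continuousAt

theorem fderiv_comp_fderiv_eq_of_eqOn {f₁ f₂ : Heis → ℝ} {O : Set Heis} (hu : u ∈ c.dom)
    (hO : O ∈ 𝓝 (c.toFun u)) (h₁ : DifferentiableAt ℝ f₁ (c.toFun u))
    (h₂ : DifferentiableAt ℝ f₂ (c.toFun u)) (heq : EqOn f₁ f₂ (M ∩ O)) :
    (fderiv ℝ f₁ (c.toFun u)).comp (fderiv ℝ c.toFun u) =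
      (fderiv ℝ f₂ (c.toFun u)).comp (fderiv ℝ c.toFun u) := by
  have hev : f₁ ∘ c.toFun =ᶠ[𝓝 u] f₂ ∘ c.toFun := by
    filter_upwards [c.isOpen_dom.mem_nhds hu, (c.continuousAt hu).preimage_mem_nhds hO]
      with v hv hvO using heq ⟨c.mapsTo hv, hvO⟩
  rw [← fderiv_comp u h₁ (c.differentiableAt hu), ← fderiv_comp u h₂ (c.differentiableAt hu)]
  exact hev.fderiv_eq

end Chart

namespace OrientedSurface

variable {k : ℕ∞ω} {S : OrientedSurface k} {g : Heis}

theorem defining_spec (S : OrientedSurface k) (hg : g ∈ S.carrier) :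
    ∃ O, g ∈ O ∧ IsDefining k S.carrier S.N O (S.defining g) := by
  have h := (S.exists_defining g hg).choose_spec.choose_spec
  refine ⟨_, h.1, ?_⟩
  rw [defining, dif_pos hg]
  exact h.2

theorem normalNear_self (hg : g ∈ S.carrier) : S.normalNear g g = S.N g := by
  obtain ⟨O, hgO, hO⟩ := S.defining_spec hg
  exact (hO.normal_eq g ⟨hg, hgO⟩).symm

theorem mem_tangent_iff (hg : g ∈ S.carrier) {v : Heis} :
    v ∈ S.tangent g ↔ coords g v ⬝ᵥ S.N g = 0 := by
  rw [tangent, LinearMap.mem_ker, ← normalNear_self hg, normalNear, ← fderiv_eq_dotProduct_grad]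
  rfl

theorem N_ne_zero (hg : g ∈ S.carrier) : S.N g ≠ 0 := by
  obtain ⟨O, hgO, hO⟩ := S.defining_spec hg
  rw [hO.normal_eq g ⟨hg, hgO⟩]
  exact hO.grad_ne_zero g hgO

theorem hlen_ne_zero (hchar : S.charLocus = ∅) (hg : g ∈ S.carrier) : hlen (S.N g) ≠ 0 := by
  intro h0
  obtain ⟨hp, hq⟩ := hlen_eq_zero_iff.1 h0
  have hω : S.N g 2 ≠ 0 := fun hω => N_ne_zero hg (by ext i; fin_cases i <;> assumption)
  have hmem : g ∈ S.charLocus := by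
    refine ⟨hg, Submodule.ext fun v => ?_⟩
    rw [mem_tangent_iff hg, mem_horizontal_iff]
    simp [dotProduct, Fin.sum_univ_three, hp, hq, hω]
  rwa [hchar] at hmem

theorem Z_mem_tangent (hg : g ∈ S.carrier) : Z S.N g ∈ S.tangent g := by
  rw [mem_tangent_iff hg, coords_Z]
  simp only [dotProduct, Fin.sum_univ_three, Matrix.cons_val, pbar, qbar]
  ring

theorem tanT_mem_tangent (hg : g ∈ S.carrier) (hW : hlen (S.N g) ≠ 0) :
    tanT S.N g ∈ S.tangent g := by
  have hW2 := hlen_sq (S.N g)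
  rw [mem_tangent_iff hg, coords_tanT]
  simp only [dotProduct, Fin.sum_univ_three, Matrix.cons_val, pbar, qbar, ombar]
  field_simp
  linear_combination S.N g 2 * hW2

theorem finrank_tangent (hg : g ∈ S.carrier) : Module.finrank ℝ (S.tangent g) = 2 := by
  obtain ⟨O, hgO, hO⟩ := S.defining_spec hg
  have hne : (fderiv ℝ (S.defining g) g).toLinearMap ≠ 0 := fun h =>
    hO.fderiv_ne_zero hgO (ContinuousLinearMap.coe_injective h)
  have hdim := Module.Dual.finrank_ker_add_one_of_ne_zero hne
  simp only [Module.finrank_prod, Module.finrank_self] at hdim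
  rw [tangent]
  omega

theorem range_fderiv_chart (hk : k ≠ 0) (c : Chart S.carrier) {u : ℝ × ℝ} (hu : u ∈ c.dom) :
    (fderiv ℝ c.toFun u).range = S.tangent (c.toFun u) := by
  have hg := c.mapsTo hu
  obtain ⟨O, hgO, hO⟩ := S.defining_spec hg
  refine Submodule.eq_of_le_of_finrank_eq ?_ ?_
  · rintro _ ⟨w, rfl⟩
    have h0 := c.fderiv_comp_fderiv_eq_of_eqOn (f₂ := fun _ => 0) hu (hO.isOpen.mem_nhds hgO)
      ((hO.contDiffAt hgO).differentiableAt hk) (differentiableAt_const 0)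
      fun x hx => (hO.mem_iff hx.2).1 hx.1
    simpa [tangent] using DFunLike.congr_fun h0 w
  · rw [finrank_tangent hg, LinearMap.finrank_range_of_inj (c.immersion u hu)]
    simp

theorem isLocallyClosed_carrier (S : OrientedSurface k) : IsLocallyClosed S.carrier := by
  refine ((isLocallyClosed_tfae S.carrier).out 0 2).2 fun g hg => ?_
  obtain ⟨O, hgO, hO⟩ := S.defining_spec hg
  refine ⟨O, hO.isOpen.mem_nhds hgO, ?_⟩
  have hpre : (Subtype.val ⁻¹' S.carrier : Set O) = O.domRestrict (S.defining g) ⁻¹' {0} := by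
    ext x
    exact hO.mem_iff x.2
  rw [hpre]
  exact isClosed_singleton.preimage hO.contDiffOn.continuousOn.domRestrict

theorem measurableSet_carrier (S : OrientedSurface k) : MeasurableSet S.carrier := by
  obtain ⟨U, C, hU, hC, hUC⟩ := S.isLocallyClosed_carrier
  rw [hUC]
  exact hU.measurableSet.inter hC.measurableSet

theorem continuousOn_N (hk : 1 ≤ k) (S : OrientedSurface k) : ContinuousOn S.N S.carrier := by
  intro g hg
  obtain ⟨O, hgO, hO⟩ := S.defining_spec hg
  have hgrad : ContinuousAt (grad (S.defining g)) g :=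
    ((contDiffOn_grad (m := 0) hO.isOpen hO.contDiffOn (by simpa using hk)).contDiffAt
      (hO.isOpen.mem_nhds hgO)).continuousAt
  refine hgrad.continuousWithinAt.congr_of_eventuallyEq ?_ (hO.normal_eq g ⟨hg, hgO⟩)
  filter_upwards [self_mem_nhdsWithin, mem_nhdsWithin_of_mem_nhds (hO.isOpen.mem_nhds hgO)]
    with x hx hxO using hO.normal_eq x ⟨hx, hxO⟩

section NonCharacteristic

variable (hk : 1 ≤ k) (hchar : S.charLocus = ∅)
include hk hchar

theorem continuousOn_N_div_hlen (i : Fin 3) :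
    ContinuousOn (fun g => S.N g i / hlen (S.N g)) S.carrier :=
  (continuousOn_pi.1 (continuousOn_N hk S) i).div
    (continuous_hlen.comp_continuousOn (continuousOn_N hk S)) fun _ hg => hlen_ne_zero hchar hg

theorem continuousOn_Z : ContinuousOn (Z S.N) S.carrier :=
  ((continuousOn_N_div_hlen hk hchar 1).smul (contDiff_X₁ 0).continuous.continuousOn).sub
    ((continuousOn_N_div_hlen hk hchar 0).smul (contDiff_X₂ 0).continuous.continuousOn)

theorem continuousOn_Y : ContinuousOn (Y S.N) S.carrier :=
  ((continuousOn_N_div_hlen hk hchar 0).smul (contDiff_X₁ 0).continuous.continuousOn).add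
    ((continuousOn_N_div_hlen hk hchar 1).smul (contDiff_X₂ 0).continuous.continuousOn)

theorem continuousOn_tanT : ContinuousOn (tanT S.N) S.carrier :=
  (contDiff_T 0).continuous.continuousOn.sub
    ((continuousOn_N_div_hlen hk hchar 2).smul (continuousOn_Y hk hchar))

end NonCharacteristic

end OrientedSurface

/-! ### Patches -/

theorem exists_equiv_fst_eq {ℓ : Heis →L[ℝ] ℝ} (hℓ : ℓ ≠ 0) :
    ∃ e : Heis ≃L[ℝ] ℝ × (ℝ × ℝ), ∀ v, (e v).1 = ℓ v := by
  have hdim := Module.Dual.finrank_ker_add_one_of_ne_zero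
    (f := ℓ.toLinearMap) fun h => hℓ (ContinuousLinearMap.coe_injective h)
  simp only [Module.finrank_prod, Module.finrank_self] at hdim
  obtain ⟨ι⟩ : Nonempty (ℓ.toLinearMap.ker ≃ₗ[ℝ] ℝ × ℝ) :=
    FiniteDimensional.nonempty_linearEquiv_of_finrank_eq (by simp; omega)
  obtain ⟨ρ, hρ⟩ := ℓ.toLinearMap.ker.subtype.exists_leftInverse_of_injective
    (Submodule.ker_subtype _)
  have hinj : Function.Injective (ℓ.toLinearMap.prod (ι.toLinearMap ∘ₗ ρ)) := by
    rw [injective_iff_map_eq_zero]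
    intro v hv
    obtain ⟨h₁, h₂⟩ := Prod.mk_eq_zero.1 hv
    have hv' : (⟨v, h₁⟩ : ℓ.toLinearMap.ker) = 0 := by
      rw [← LinearMap.id_apply (R := ℝ) (⟨v, h₁⟩ : ℓ.toLinearMap.ker), ← hρ]
      exact ι.map_eq_zero_iff.1 h₂
    exact congrArg Subtype.val hv'
  exact ⟨(LinearEquiv.ofInjectiveEndo _ hinj).toContinuousLinearEquiv, fun _ => rfl⟩

theorem exists_levelSet_parametrization {E F G : Type*} [NormedAddCommGroup E] [NormedSpace ℝ E]
    [CompleteSpace E] [NormedAddCommGroup F] [NormedSpace ℝ F] [NormedAddCommGroup G]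
    [NormedSpace ℝ G] {m : ℕ∞ω} (hm : m ≠ 0) (hm' : m ≠ ∞) {φ : E → F} {g : E}
    (hφ : ContDiffAt ℝ m φ g) (hφg : φ g = 0) {e : E ≃L[ℝ] F × G}
    (he : ∀ v, (e v).1 = fderiv ℝ φ g v) {O : Set E} (hO : O ∈ 𝓝 g) :
    ∃ (U : Set E) (V : Set G) (σ : G → E), IsOpen U ∧ U ⊆ O ∧ g ∈ U ∧ IsOpen V ∧
      IsPreconnected V ∧ ContDiffOn ℝ m σ V ∧
      (∀ u ∈ V, σ u ∈ U ∧ φ (σ u) = 0 ∧ (e (σ u)).2 = u) ∧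
      ∀ x ∈ U, φ x = 0 → (e x).2 ∈ V ∧ σ (e x).2 = x := by
  let Φ : E → F × G := fun x => (φ x, (e x).2)
  have hΦ : ContDiffAt ℝ m Φ g := hφ.prodMk (by fun_prop)
  have hderiv : HasFDerivAt Φ (e : E →L[ℝ] F × G) g := by
    have he' : (e : E →L[ℝ] F × G) = (fderiv ℝ φ g).prod
        ((ContinuousLinearMap.snd ℝ F G).comp (e : E →L[ℝ] F × G)) :=
      ContinuousLinearMap.ext fun v => Prod.ext (he v) rfl
    rw [he']
    exact (hφ.differentiableAt hm).hasFDerivAt.prodMk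
      ((ContinuousLinearMap.snd ℝ F G).comp (e : E →L[ℝ] F × G)).hasFDerivAt
  let H := hΦ.toOpenPartialHomeomorph Φ hderiv hm
  have hgH : g ∈ H.source := hΦ.mem_toOpenPartialHomeomorph_source hderiv hm
  have hHg : H g = (0, (e g).2) := Prod.ext hφg rfl
  have hsymm : ContDiffAt ℝ m H.symm (H g) := hΦ.to_localInverse hderiv hm
  have hgood : ∀ᶠ y in 𝓝 (H g), y ∈ H.target ∧ ContDiffAt ℝ m H.symm y ∧
      H.symm y ∈ interior O :=
    (H.open_target.eventually_mem (H.map_source hgH)).and <| (hsymm.eventually hm').and <|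
      hsymm.continuousAt.eventually_mem (by rwa [H.left_inv hgH, interior_mem_nhds])
  have hslice : ContinuousAt (fun u : G => ((0, u) : F × G)) (e g).2 := by fun_prop
  rw [hHg] at hgood
  obtain ⟨r, hr, hball⟩ := Metric.eventually_nhds_iff_ball.1 (hslice.eventually hgood)
  have hright (u) (hu : u ∈ Metric.ball (e g).2 r) : Φ (H.symm (0, u)) = (0, u) :=
    H.right_inv (hball u hu).1
  refine ⟨H.source ∩ interior O ∩ (fun x => (e x).2) ⁻¹' Metric.ball (e g).2 r,
    Metric.ball (e g).2 r, fun u => H.symm (0, u), ?_, fun x hx => interior_subset hx.1.2, ?_,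
    Metric.isOpen_ball, (convex_ball _ _).isPreconnected, fun u hu => ?_, fun u hu => ?_, ?_⟩
  · exact (H.open_source.inter isOpen_interior).inter (Metric.isOpen_ball.preimage (by fun_prop))
  · exact ⟨⟨hgH, mem_interior_iff_mem_nhds.2 hO⟩, Metric.mem_ball_self hr⟩
  · exact (ContDiffAt.comp u (hball u hu).2.1 (by fun_prop)).contDiffWithinAt
  · have hsnd : (e (H.symm (0, u))).2 = u := congrArg Prod.snd (hright u hu)
    refine ⟨⟨⟨H.map_target (hball u hu).1, (hball u hu).2.2⟩, ?_⟩, congrArg Prod.fst (hright u hu),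
      hsnd⟩
    rwa [mem_preimage, hsnd]
  · rintro x ⟨⟨hxH, -⟩, hxV⟩ hφx
    have hHx : H x = (0, (e x).2) := Prod.ext hφx rfl
    exact ⟨hxV, (congrArg H.symm hHx).symm.trans (H.left_inv hxH)⟩

/-- The chart given by a `C¹` map with a linear left inverse. -/
def Chart.ofLeftInvOn {M : Set Heis} {V : Set (ℝ × ℝ)} {σ : ℝ × ℝ → Heis}
    (π : Heis →L[ℝ] ℝ × ℝ) (hV : IsOpen V) (hσ : ContDiffOn ℝ 1 σ V) (hπ : LeftInvOn π σ V)
    (hM : MapsTo σ V M) : Chart M where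
  dom := V
  toFun := σ
  isOpen_dom := hV
  contDiffOn := hσ
  injOn := hπ.injOn
  immersion := fun u hu => by
    have hdiff := (hσ.contDiffAt (hV.mem_nhds hu)).differentiableAt one_ne_zero
    have hid : π.comp (fderiv ℝ σ u) = ContinuousLinearMap.id ℝ (ℝ × ℝ) := by
      refine (π.hasFDerivAt.comp u hdiff.hasFDerivAt).unique
        ((hasFDerivAt_id u).congr_of_eventuallyEq ?_)
      filter_upwards [hV.mem_nhds hu] with v hv using hπ hv
    exact Function.LeftInverse.injective (g := π) (DFunLike.congr_fun hid)
  mapsTo := hM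

/-- A `C^m` chart of `M` with connected domain which covers the part of `M` in an open set `nhd`
and whose inverse is the restriction of a linear map. -/
structure Patch (m : ℕ∞ω) (M : Set Heis) extends Chart M where
  contDiffOn_patch : ContDiffOn ℝ m toFun dom
  isPreconnected_dom : IsPreconnected dom
  /-- the open set in which the patch covers `M` -/
  nhd : Set Heis
  isOpen_nhd : IsOpen nhd
  mapsTo_nhd : MapsTo toFun dom nhd
  /-- the linear map that inverts the parametrization -/
  proj : Heis →L[ℝ] ℝ × ℝ
  proj_toFun : LeftInvOn proj toFun dom
  proj_mem : MapsTo proj (M ∩ nhd) dom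
  toFun_proj : LeftInvOn toFun proj (M ∩ nhd)

theorem IsDefining.exists_patch {m : ℕ∞ω} (hm : 1 ≤ m) (hm' : m ≠ ∞) {M O : Set Heis}
    {N : Heis → Fin 3 → ℝ} {φ : Heis → ℝ} (h : IsDefining m M N O φ) {g : Heis}
    (hg : g ∈ M ∩ O) : ∃ P : Patch m M, g ∈ P.nhd := by
  obtain ⟨e, he⟩ := exists_equiv_fst_eq (h.fderiv_ne_zero hg.2)
  obtain ⟨U, V, σ, hU, hUO, hgU, hV, hVc, hσ, hσV, hUV⟩ :=
    exists_levelSet_parametrization (zero_lt_one.trans_le hm).ne' hm' (h.contDiffAt hg.2)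
      ((h.mem_iff hg.2).1 hg.1) he (h.isOpen.mem_nhds hg.2)
  have hUM (x) (hx : x ∈ M ∩ U) := hUV x hx.2 ((h.mem_iff (hUO hx.2)).1 hx.1)
  exact ⟨{
    Chart.ofLeftInvOn ((ContinuousLinearMap.snd ℝ ℝ (ℝ × ℝ)).comp (e : Heis →L[ℝ] ℝ × (ℝ × ℝ)))
      hV (hσ.of_le hm) (fun u hu => (hσV u hu).2.2)
      (fun u hu => (h.mem_iff (hUO (hσV u hu).1)).2 (hσV u hu).2.1) with
    contDiffOn_patch := hσ
    isPreconnected_dom := hVc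
    nhd := U
    isOpen_nhd := hU
    mapsTo_nhd := fun u hu => (hσV u hu).1
    proj := (ContinuousLinearMap.snd ℝ ℝ (ℝ × ℝ)).comp (e : Heis →L[ℝ] ℝ × (ℝ × ℝ))
    proj_toFun := fun u hu => (hσV u hu).2.2
    proj_mem := fun x hx => (hUM x hx).1
    toFun_proj := fun x hx => (hUM x hx).2 }, hgU⟩

namespace OrientedSurface

variable {k : ℕ∞ω} {S : OrientedSurface k} {g : Heis}

theorem exists_patch {m : ℕ∞ω} (hm : 1 ≤ m) (hm' : m ≠ ∞) (hk : m ≤ k) (hg : g ∈ S.carrier) :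
    ∃ P : Patch m S.carrier, g ∈ P.nhd := by
  obtain ⟨O, hgO, hO⟩ := S.defining_spec hg
  exact (hO.of_le hk).exists_patch hm hm' ⟨hg, hgO⟩

theorem fderiv_eq_of_eqOn (hk : 1 ≤ k) {f₁ f₂ : Heis → ℝ} {O : Set Heis} (hg : g ∈ S.carrier)
    (hO : O ∈ 𝓝 g) (h₁ : DifferentiableAt ℝ f₁ g) (h₂ : DifferentiableAt ℝ f₂ g)
    (heq : EqOn f₁ f₂ (S.carrier ∩ O)) {v : Heis} (hv : v ∈ S.tangent g) :
    fderiv ℝ f₁ g v = fderiv ℝ f₂ g v := by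
  obtain ⟨P, hgP⟩ := S.exists_patch le_rfl (by simp) hk hg
  have hu := P.proj_mem ⟨hg, hgP⟩
  have hPg : P.toFun (P.proj g) = g := P.toFun_proj ⟨hg, hgP⟩
  generalize P.proj g = u at hu hPg
  subst hPg
  rw [← range_fderiv_chart (zero_lt_one.trans_le hk).ne' P.toChart hu] at hv
  obtain ⟨w, rfl⟩ := hv
  exact DFunLike.congr_fun (P.fderiv_comp_fderiv_eq_of_eqOn hu hO h₁ h₂ heq) w

end OrientedSurface

/-! ### The `H`-perimeter measure in charts -/

theorem continuous_coords : Continuous fun p : Heis × Heis => coords p.1 p.2 := by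
  unfold coords
  fun_prop

namespace Chart

variable {M : Set Heis} (c : Chart M)

theorem measurableSet_inter_preimage {B : Set Heis} (hB : MeasurableSet B) :
    MeasurableSet (c.dom ∩ c.toFun ⁻¹' B) := by
  have hc : Measurable (c.dom.domRestrict c.toFun) :=
    (continuousOn_iff_continuous_domRestrict.1 c.contDiffOn.continuousOn).measurable
  simpa [preimage_comp, domRestrict_eq, Subtype.image_preimage_coe] using
    c.isOpen_dom.measurableSet.subtype_image (hc hB)

theorem aemeasurable_toFun : AEMeasurable c.toFun (volume.restrict c.dom) :=
  c.contDiffOn.continuousOn.aemeasurable c.isOpen_dom.measurableSet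

theorem continuousOn_fderiv : ContinuousOn (fderiv ℝ c.toFun) c.dom :=
  c.contDiffOn.continuousOn_fderiv_of_isOpen c.isOpen_dom le_rfl

theorem continuousOn_coords_fderiv (w : ℝ × ℝ) :
    ContinuousOn (fun u => coords (c.toFun u) (fderiv ℝ c.toFun u w)) c.dom :=
  continuous_coords.comp_continuousOn
    (c.contDiffOn.continuousOn.prodMk (c.continuousOn_fderiv.clm_apply continuousOn_const))

theorem continuousOn_normal : ContinuousOn c.normal c.dom := by
  have hcross : Continuous fun p : (Fin 3 → ℝ) × (Fin 3 → ℝ) => crossProduct p.1 p.2 := by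
    simp only [cross_apply]
    fun_prop
  exact hcross.comp_continuousOn
    ((c.continuousOn_coords_fderiv _).prodMk (c.continuousOn_coords_fderiv _))

theorem aemeasurable_hlen_normal :
    AEMeasurable (fun u => hlen (c.normal u)) (volume.restrict c.dom) :=
  (continuous_hlen.comp_continuousOn c.continuousOn_normal).aemeasurable
    c.isOpen_dom.measurableSet

theorem hPerimeter_eq_map_withDensity :
    c.hPerimeter = Measure.map c.toFun
      ((volume.restrict c.dom).withDensity fun u => ENNReal.ofReal (hlen (c.normal u))) := by
  simp only [hPerimeter, hlen_div_len_mul_len]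

theorem setLIntegral_hPerimeter {B : Set Heis} (hB : MeasurableSet B) {f : Heis → ENNReal}
    (hf : Measurable f) :
    ∫⁻ x in B, f x ∂c.hPerimeter =
      ∫⁻ u in c.dom ∩ c.toFun ⁻¹' B, ENNReal.ofReal (hlen (c.normal u)) * f (c.toFun u) := by
  have hm := c.isOpen_dom.measurableSet
  have hc := c.aemeasurable_toFun
  rw [← lintegral_indicator hB, hPerimeter_eq_map_withDensity,
    lintegral_map' (hf.indicator hB).aemeasurable
      (hc.mono_ac (withDensity_absolutelyContinuous _ _)),
    lintegral_withDensity_eq_lintegral_mul₀ (g := fun u => B.indicator f (c.toFun u))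
      c.aemeasurable_hlen_normal.ennreal_ofReal ((hf.indicator hB).comp_aemeasurable hc),
    inter_comm, ← Measure.restrict_restrict' hm,
    ← lintegral_indicator₀ (hc.nullMeasurable hB)]
  refine lintegral_congr fun u => ?_
  by_cases hu : c.toFun u ∈ B <;> simp [hu]

theorem hPerimeter_apply {B : Set Heis} (hB : MeasurableSet B) :
    c.hPerimeter B = ∫⁻ u in c.dom ∩ c.toFun ⁻¹' B, ENNReal.ofReal (hlen (c.normal u)) := by
  simpa using c.setLIntegral_hPerimeter hB measurable_const (f := fun _ => 1)

theorem integral_hPerimeter {F : Heis → ℝ} (hF : AEStronglyMeasurable F c.hPerimeter) :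
    ∫ g, F g ∂c.hPerimeter = ∫ u in c.dom, hlen (c.normal u) * F (c.toFun u) := by
  rw [hPerimeter_eq_map_withDensity] at hF ⊢
  rw [integral_map (c.aemeasurable_toFun.mono_ac (withDensity_absolutelyContinuous _ _)) hF,
    integral_withDensity_eq_integral_toReal_smul₀ c.aemeasurable_hlen_normal.ennreal_ofReal
      (Eventually.of_forall fun _ => ENNReal.ofReal_lt_top)]
  simp only [ENNReal.toReal_ofReal (Real.sqrt_nonneg _), smul_eq_mul, hlen]

theorem ae_mem_of_mapsTo {B : Set Heis} (hB : MeasurableSet B) (hc : MapsTo c.toFun c.dom B) :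
    ∀ᵐ g ∂c.hPerimeter, g ∈ B := by
  have hempty : c.dom ∩ c.toFun ⁻¹' Bᶜ = ∅ := by
    rw [← disjoint_iff_inter_eq_empty, preimage_compl, disjoint_compl_right_iff_subset]
    exact hc
  change c.hPerimeter Bᶜ = 0
  rw [c.hPerimeter_apply hB.compl, hempty, Measure.restrict_empty, lintegral_zero_measure]

end Chart

namespace Patch

variable {m : ℕ∞ω} {M : Set Heis} (P : Patch m M) (c : Chart M) {u : ℝ × ℝ}

theorem fderiv_comp_fderiv_proj (hu : u ∈ c.dom) (huP : c.toFun u ∈ P.nhd) :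
    (fderiv ℝ P.toFun (P.proj (c.toFun u))).comp (P.proj.comp (fderiv ℝ c.toFun u)) =
      fderiv ℝ c.toFun u := by
  have hproj := P.proj.hasFDerivAt.comp u (c.differentiableAt hu).hasFDerivAt
  have hP := (P.differentiableAt (P.proj_mem ⟨c.mapsTo hu, huP⟩)).hasFDerivAt.comp u hproj
  refine ((hP.congr_of_eventuallyEq ?_).fderiv).symm
  filter_upwards [c.isOpen_dom.mem_nhds hu,
    (c.continuousAt hu).preimage_mem_nhds (P.isOpen_nhd.mem_nhds huP)]
    with v hv hvP using (P.toFun_proj ⟨c.mapsTo hv, hvP⟩).symm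

theorem normal_eq_det_smul (hu : u ∈ c.dom) (huP : c.toFun u ∈ P.nhd) :
    c.normal u = (P.proj.comp (fderiv ℝ c.toFun u)).det • P.normal (P.proj (c.toFun u)) := by
  have hcross := crossProduct_comp_eq_det_smul (P.proj.comp (fderiv ℝ c.toFun u))
    ((coordsL (c.toFun u)).comp (fderiv ℝ P.toFun (P.proj (c.toFun u))))
  have hD := DFunLike.congr_fun (P.fderiv_comp_fderiv_proj c hu huP)
  simp only [ContinuousLinearMap.comp_apply, coordsL_apply] at hcross hD
  rw [Chart.normal, Chart.normal, P.toFun_proj ⟨c.mapsTo hu, huP⟩, ← hcross, hD, hD]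

theorem restrict_chart_hPerimeter_le : c.hPerimeter.restrict P.nhd ≤ P.hPerimeter := by
  refine Measure.le_iff.2 fun B hB => ?_
  rw [Measure.restrict_apply hB]
  have hB' : MeasurableSet (B ∩ P.nhd) := hB.inter P.isOpen_nhd.measurableSet
  have hmem {u} (hu : u ∈ c.dom ∩ c.toFun ⁻¹' (B ∩ P.nhd)) : c.toFun u ∈ M ∩ P.nhd :=
    ⟨c.mapsTo hu.1, hu.2.2⟩
  calc c.hPerimeter (B ∩ P.nhd)
      = ∫⁻ u in c.dom ∩ c.toFun ⁻¹' (B ∩ P.nhd),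
          ENNReal.ofReal |(P.proj.comp (fderiv ℝ c.toFun u)).det| *
            ENNReal.ofReal (hlen (P.normal (P.proj (c.toFun u)))) := by
        rw [c.hPerimeter_apply hB']
        refine setLIntegral_congr_fun (c.measurableSet_inter_preimage hB') fun u hu => ?_
        rw [P.normal_eq_det_smul c hu.1 hu.2.2, hlen_smul, ENNReal.ofReal_mul (abs_nonneg _)]
    _ = ∫⁻ v in (P.proj ∘ c.toFun) '' (c.dom ∩ c.toFun ⁻¹' (B ∩ P.nhd)),
          ENNReal.ofReal (hlen (P.normal v)) := by
        refine (lintegral_image_eq_lintegral_abs_det_fderiv_mul volume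
          (c.measurableSet_inter_preimage hB') (fun u hu => (P.proj.hasFDerivAt.comp u
            (c.differentiableAt hu.1).hasFDerivAt).hasFDerivWithinAt) ?_
          fun v => ENNReal.ofReal (hlen (P.normal v))).symm
        exact P.toFun_proj.injOn.comp (c.injOn.mono inter_subset_left) fun u => hmem
    _ ≤ P.hPerimeter B := by
        rw [P.hPerimeter_apply hB]
        refine lintegral_mono_set (image_subset_iff.2 fun u hu => ⟨P.proj_mem (hmem hu), ?_⟩)
        rw [mem_preimage, Function.comp_apply, P.toFun_proj (hmem hu)]
        exact hu.2.1

theorem restrict_hPerimeter : (Heis.hPerimeter M).restrict P.nhd = P.hPerimeter := by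
  have hP : P.hPerimeter.restrict P.nhd = P.hPerimeter :=
    Measure.restrict_eq_self_of_ae_mem
      (P.ae_mem_of_mapsTo P.isOpen_nhd.measurableSet P.mapsTo_nhd)
  refine le_antisymm ?_ ?_
  · have hle : Heis.hPerimeter M ≤ P.hPerimeter + (Heis.hPerimeter M).restrict P.nhdᶜ := by
      refine iSup_le fun c => ?_
      rw [← Measure.restrict_add_restrict_compl (μ := c.hPerimeter)
        P.isOpen_nhd.measurableSet]
      exact add_le_add (P.restrict_chart_hPerimeter_le c)
        (Measure.restrict_mono_measure (le_iSup Chart.hPerimeter c) _)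
    simpa [Measure.restrict_add, hP, Measure.restrict_restrict P.isOpen_nhd.measurableSet] using
      Measure.restrict_mono_measure hle P.nhd
  · rw [← hP]
    exact Measure.restrict_mono_measure (le_iSup Chart.hPerimeter P.toChart) _

end Patch

namespace OrientedSurface

variable {k : ℕ∞ω} (S : OrientedSurface k) (c : Chart S.carrier)

/-- The derivative of a chart of a surface, in the frame `Z, T - ω̄ Y` of the tangent planes. -/
def frameDeriv (u : ℝ × ℝ) : ℝ × ℝ →L[ℝ] ℝ × ℝ :=
  (tangentCoords S.N (c.toFun u)).comp (fderiv ℝ c.toFun u)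

variable {S} (hk : 1 ≤ k) (hchar : S.charLocus = ∅)
include hk hchar

theorem tangentFrame_comp_frameDeriv {u : ℝ × ℝ} (hu : u ∈ c.dom) :
    (tangentFrame S.N (c.toFun u)).comp (S.frameDeriv c u) = fderiv ℝ c.toFun u := by
  refine ContinuousLinearMap.ext fun w => ?_
  refine tangentFrame_tangentCoords (hlen_ne_zero hchar (c.mapsTo hu)) ?_
  rw [← mem_tangent_iff (c.mapsTo hu),
    ← range_fderiv_chart (zero_lt_one.trans_le hk).ne' c hu]
  exact ⟨w, rfl⟩

theorem det_frameDeriv_ne_zero {u : ℝ × ℝ} (hu : u ∈ c.dom) : (S.frameDeriv c u).det ≠ 0 := by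
  intro h0
  obtain ⟨w, hw, hw0⟩ := (Submodule.ne_bot_iff _).1 (LinearMap.bot_lt_ker_of_det_eq_zero h0).ne'
  refine hw0 (c.immersion u hu ?_)
  rw [← tangentFrame_comp_frameDeriv c hk hchar hu, map_zero, ContinuousLinearMap.comp_apply,
    show S.frameDeriv c u w = 0 from hw, map_zero]

theorem hlen_normal_eq_abs_det {u : ℝ × ℝ} (hu : u ∈ c.dom) :
    hlen (c.normal u) = |(S.frameDeriv c u).det| := by
  have hcross := crossProduct_comp_eq_det_smul (S.frameDeriv c u)
    ((coordsL (c.toFun u)).comp (tangentFrame S.N (c.toFun u)))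
  have hD := DFunLike.congr_fun (tangentFrame_comp_frameDeriv c hk hchar hu)
  simp only [ContinuousLinearMap.comp_apply, coordsL_apply] at hcross hD
  rw [Chart.normal, ← hD, ← hD, hcross, hlen_smul, tangentFrame_apply, tangentFrame_apply]
  simp [hlen_crossProduct_frame (hlen_ne_zero hchar (c.mapsTo hu))]

theorem continuousOn_det_frameDeriv :
    ContinuousOn (fun u => (S.frameDeriv c u).det) c.dom := by
  have happly (w : ℝ × ℝ) : ContinuousOn (fun u => S.frameDeriv c u w) c.dom := by
    have hcoords := continuousOn_pi.1 (c.continuousOn_coords_fderiv w)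
    have hν (i : Fin 3) := (continuousOn_N_div_hlen hk hchar i).comp c.contDiffOn.continuousOn
      c.mapsTo
    simp only [frameDeriv, ContinuousLinearMap.comp_apply, tangentCoords_apply]
    exact (((hν 1).mul (hcoords 0)).sub ((hν 0).mul (hcoords 1))).prodMk (hcoords 2)
  simp only [det_prod_real]
  exact ((happly _).fst.mul (happly _).snd).sub ((happly _).fst.mul (happly _).snd)

theorem exists_hlen_normal_eq_mul_det (hc : IsPreconnected c.dom) :
    ∃ ε : ℝ, ∀ u ∈ c.dom, hlen (c.normal u) = ε * (S.frameDeriv c u).det := by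
  have hdet := continuousOn_det_frameDeriv c hk hchar
  rcases hc.eq_or_eq_neg_of_sq_eq hdet.abs hdet (fun u _ => by simp)
    (fun hu => det_frameDeriv_ne_zero c hk hchar hu) with h | h
  · exact ⟨1, fun u hu => by rw [hlen_normal_eq_abs_det c hk hchar hu, one_mul]; exact h hu⟩
  · exact ⟨-1, fun u hu => by rw [hlen_normal_eq_abs_det c hk hchar hu, neg_one_mul]; exact h hu⟩

end OrientedSurface

/-! ### Stokes' theorem -/

theorem contDiff_indicator {E F : Type*} [NormedAddCommGroup E] [NormedSpace ℝ E]
    [NormedAddCommGroup F] [NormedSpace ℝ F] {n : ℕ∞ω} {f : E → F} {U L : Set E} (hU : IsOpen U)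
    (hL : IsClosed L) (hLU : L ⊆ U) (hf : ContDiffOn ℝ n f U) (h0 : ∀ x ∈ U \ L, f x = 0) :
    ContDiff ℝ n (U.indicator f) := by
  refine contDiff_iff_contDiffAt.2 fun x => ?_
  by_cases hx : x ∈ U
  · refine (hf.contDiffAt (hU.mem_nhds hx)).congr_of_eventuallyEq ?_
    filter_upwards [hU.mem_nhds hx] with y hy using indicator_of_mem hy f
  · refine (contDiffAt_const (c := 0)).congr_of_eventuallyEq ?_
    filter_upwards [hL.isOpen_compl.mem_nhds fun h => hx (hLU h)] with y hy
    exact indicator_apply_eq_zero.2 fun hyU => h0 y ⟨hyU, hy⟩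

section FiniteDimensional

variable {E : Type*} [NormedAddCommGroup E] [NormedSpace ℝ E] [FiniteDimensional ℝ E]

theorem exists_contDiff_eq_nhdsSet {n : ℕ∞} {f : E → ℝ} {U L : Set E} (hU : IsOpen U)
    (hL : IsCompact L) (hLU : L ⊆ U) (hf : ContDiffOn ℝ n f U) :
    ∃ F : E → ℝ, ContDiff ℝ n F ∧ ∀ᶠ x in 𝓝ˢ L, F x = f x := by
  obtain ⟨L', hL', hLL', hL'U⟩ := exists_compact_between hL hU hLU
  obtain ⟨χ, hχ1, hχ0, -⟩ := exists_contMDiffMap_one_nhds_of_subset_interior (n := n)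
    𝓘(ℝ, E) hL.isClosed hLL'
  refine ⟨U.indicator fun x => χ x * f x,
    contDiff_indicator hU hL'.isClosed hL'U (χ.contMDiff.contDiff.contDiffOn.mul hf)
      fun x hx => by rw [hχ0 x hx.2, zero_mul], ?_⟩
  filter_upwards [hχ1, hU.mem_nhdsSet.2 hLU] with x hx hxU
  rw [indicator_of_mem hxU, hx, one_mul]

variable [MeasurableSpace E] [BorelSpace E] {μ : Measure E} [μ.IsAddHaarMeasure]

theorem integral_fderiv_mul_fderiv_comm {f p : E → ℝ} (hf : ContDiff ℝ 1 f)
    (hfc : HasCompactSupport f) (hp : ContDiff ℝ 2 p) (v w : E) :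
    ∫ x, fderiv ℝ f x v * fderiv ℝ p x w ∂μ = ∫ x, fderiv ℝ f x w * fderiv ℝ p x v ∂μ := by
  have hdp (v : E) : ContDiff ℝ 1 fun x => fderiv ℝ p x v :=
    (hp.fderiv_right (by norm_num)).clm_apply contDiff_const
  have hdf (v : E) : Continuous fun x => fderiv ℝ f x v :=
    (hf.continuous_fderiv one_ne_zero).clm_apply continuous_const
  have hsymm (x : E) : fderiv ℝ (fun x => fderiv ℝ p x w) x v =
      fderiv ℝ (fun x => fderiv ℝ p x v) x w := by
    have hd : DifferentiableAt ℝ (fderiv ℝ p) x :=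
      (hp.fderiv_right (m := 1) (by norm_num)).differentiable one_ne_zero x
    rw [fderiv_clm_apply hd (differentiableAt_const _),
      fderiv_clm_apply hd (differentiableAt_const _)]
    simpa using hp.contDiffAt.isSymmSndFDerivAt (by simp) v w
  have byParts (v w : E) : ∫ x, f x * fderiv ℝ (fun x => fderiv ℝ p x w) x v ∂μ =
      -∫ x, fderiv ℝ f x v * fderiv ℝ p x w ∂μ :=
    integral_mul_fderiv_eq_neg_fderiv_mul_of_integrable
      (((hdf v).mul (hdp w).continuous).integrable_of_hasCompactSupport
        ((hfc.fderiv_apply (𝕜 := ℝ) v).mul_right))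
      ((hf.continuous.mul (((hdp w).continuous_fderiv one_ne_zero).clm_apply
        continuous_const)).integrable_of_hasCompactSupport hfc.mul_right)
      ((hf.continuous.mul (hdp w).continuous).integrable_of_hasCompactSupport hfc.mul_right)
      (fun x _ => hf.differentiable one_ne_zero x)
      (fun x _ => (hdp w).differentiable one_ne_zero x)
  rw [← neg_inj, ← byParts, ← byParts]
  simp only [hsymm]

theorem setIntegral_fderiv_wedge_eq_zero {f p : E → ℝ} {U L : Set E} (hU : IsOpen U)
    (hL : IsCompact L) (hLU : L ⊆ U) (hf : ContDiffOn ℝ 1 f U) (h0 : ∀ x ∈ U \ L, f x = 0)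
    (hp : ContDiffOn ℝ 2 p U) (v w : E) :
    ∫ x in U, (fderiv ℝ f x v * fderiv ℝ p x w - fderiv ℝ f x w * fderiv ℝ p x v) ∂μ = 0 := by
  obtain ⟨p', hp', hpp'⟩ := exists_contDiff_eq_nhdsSet (n := 2) hU hL hLU hp
  have hf' := contDiff_indicator hU hL.isClosed hLU hf h0
  have hoff {x : E} (hx : x ∉ L) : U.indicator f =ᶠ[𝓝 x] fun _ => 0 := by
    filter_upwards [hL.isClosed.isOpen_compl.mem_nhds hx] with y hy
    exact indicator_apply_eq_zero.2 fun hyU => h0 y ⟨hyU, hy⟩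
  have hfc : HasCompactSupport (U.indicator f) :=
    HasCompactSupport.intro hL fun x hx => (hoff hx).self_of_nhds
  have hcongr : EqOn
      (fun x => fderiv ℝ f x v * fderiv ℝ p x w - fderiv ℝ f x w * fderiv ℝ p x v)
      (fun x => fderiv ℝ (U.indicator f) x v * fderiv ℝ p' x w -
        fderiv ℝ (U.indicator f) x w * fderiv ℝ p' x v) U := fun x hx => by
    have hfx : fderiv ℝ f x = fderiv ℝ (U.indicator f) x :=
      (eventuallyEq_of_mem (hU.mem_nhds hx) (eqOn_indicator (f := f))).fderiv_eq.symm
    by_cases hxL : x ∈ L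
    · have hpx : p' =ᶠ[𝓝 x] p := hpp'.filter_mono (nhds_le_nhdsSet hxL)
      simp only [hfx, hpx.fderiv_eq]
    · simp [hfx, (hoff hxL).fderiv_eq]
  have hinteg (v w : E) :
      Integrable (fun x => fderiv ℝ (U.indicator f) x v * fderiv ℝ p' x w) μ :=
    (((hf'.continuous_fderiv one_ne_zero).clm_apply continuous_const).mul
      ((hp'.continuous_fderiv two_ne_zero).clm_apply
        continuous_const)).integrable_of_hasCompactSupport
      (hfc.fderiv_apply (𝕜 := ℝ) v).mul_right
  rw [setIntegral_congr_fun hU.measurableSet hcongr,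
    setIntegral_eq_integral_of_forall_compl_eq_zero fun x hx => by
      simp [(hoff fun h => hx (hLU h)).fderiv_eq],
    integral_sub (hinteg v w) (hinteg w v),
    integral_fderiv_mul_fderiv_comm hf' hfc hp' v w, sub_self]

end FiniteDimensional

namespace OrientedSurface

variable {k : ℕ∞ω} (S : OrientedSurface k)

/-- The Poisson bracket of two functions on a surface, for the area form of `σ_H`: the value of
`dA ∧ dB` on `(Z, T - ω̄ Y)`. -/
def bracket (A B : Heis → ℝ) (g : Heis) : ℝ :=
  fderiv ℝ A g (Z S.N g) * fderiv ℝ B g (tanT S.N g) -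
    fderiv ℝ A g (tanT S.N g) * fderiv ℝ B g (Z S.N g)

variable {S} {K : Set Heis} {A B : Heis → ℝ}

theorem integrableOn_of_continuousOn (hK : IsCompact K) (hfin : hPerimeter S.carrier K < ⊤)
    {F : Heis → ℝ} (hF : ContinuousOn F K) (h0 : ∀ g ∈ S.carrier \ K, F g = 0) :
    IntegrableOn F S.carrier (hPerimeter S.carrier) :=
  (hF.integrableOn_of_subset_isCompact hK hK.measurableSet subset_rfl
    hfin.ne).of_forall_sdiff_eq_zero S.measurableSet_carrier h0

theorem fderiv_eq_zero_of_mem_tangent (hk : 1 ≤ k) (hK : IsClosed K) {g : Heis}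
    (hA : DifferentiableAt ℝ A g) (h0 : ∀ g ∈ S.carrier \ K, A g = 0) (hg : g ∈ S.carrier \ K)
    {v : Heis} (hv : v ∈ S.tangent g) : fderiv ℝ A g v = 0 := by
  simpa using fderiv_eq_of_eqOn hk (f₂ := fun _ => 0) hg.1 (hK.isOpen_compl.mem_nhds hg.2) hA
    (differentiableAt_const _) h0 hv

variable (hk : 1 ≤ k) (hchar : S.charLocus = ∅)
include hk hchar

theorem continuousOn_fderiv_Z (hA : ContDiff ℝ 1 A) :
    ContinuousOn (fun g => fderiv ℝ A g (Z S.N g)) S.carrier :=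
  (hA.continuous_fderiv one_ne_zero).continuousOn.clm_apply (continuousOn_Z hk hchar)

theorem continuousOn_fderiv_tanT (hA : ContDiff ℝ 1 A) :
    ContinuousOn (fun g => fderiv ℝ A g (tanT S.N g)) S.carrier :=
  (hA.continuous_fderiv one_ne_zero).continuousOn.clm_apply (continuousOn_tanT hk hchar)

theorem continuousOn_bracket (hA : ContDiff ℝ 1 A) (hB : ContDiff ℝ 1 B) :
    ContinuousOn (S.bracket A B) S.carrier :=
  ((continuousOn_fderiv_Z hk hchar hA).mul (continuousOn_fderiv_tanT hk hchar hB)).sub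
    ((continuousOn_fderiv_tanT hk hchar hA).mul (continuousOn_fderiv_Z hk hchar hB))

theorem bracket_eq_zero_of_notMem (hK : IsClosed K) (hA : ContDiff ℝ 1 A)
    (h0 : ∀ g ∈ S.carrier \ K, A g = 0) {g : Heis} (hg : g ∈ S.carrier \ K) :
    S.bracket A B g = 0 := by
  have hdA {v : Heis} (hv : v ∈ S.tangent g) : fderiv ℝ A g v = 0 :=
    fderiv_eq_zero_of_mem_tangent hk hK (hA.differentiable one_ne_zero g) h0 hg hv
  rw [bracket, hdA (Z_mem_tangent hg.1),
    hdA (tanT_mem_tangent hg.1 (hlen_ne_zero hchar hg.1)), zero_mul, zero_mul, sub_zero]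

theorem integrableOn_bracket (hK : IsCompact K) (hKS : K ⊆ S.carrier)
    (hfin : hPerimeter S.carrier K < ⊤) (hA : ContDiff ℝ 1 A)
    (h0 : ∀ g ∈ S.carrier \ K, A g = 0) (hB : ContDiff ℝ 1 B) :
    IntegrableOn (S.bracket A B) S.carrier (hPerimeter S.carrier) :=
  integrableOn_of_continuousOn hK hfin ((continuousOn_bracket hk hchar hA hB).mono hKS)
    fun _ hg => bracket_eq_zero_of_notMem hk hchar hK.isClosed hA h0 hg

theorem det_frameDeriv_mul_bracket (c : Chart S.carrier) {u : ℝ × ℝ} (hu : u ∈ c.dom)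
    (hA : ContDiff ℝ 1 A) (hB : ContDiff ℝ 1 B) :
    (S.frameDeriv c u).det * S.bracket A B (c.toFun u) =
      fderiv ℝ (A ∘ c.toFun) u (1, 0) * fderiv ℝ (B ∘ c.toFun) u (0, 1) -
        fderiv ℝ (A ∘ c.toFun) u (0, 1) * fderiv ℝ (B ∘ c.toFun) u (1, 0) := by
  have h := mul_sub_mul_comp_eq_det_mul (S.frameDeriv c u)
    ((fderiv ℝ A (c.toFun u)).comp (tangentFrame S.N (c.toFun u)))
    ((fderiv ℝ B (c.toFun u)).comp (tangentFrame S.N (c.toFun u)))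
  have hD := DFunLike.congr_fun (tangentFrame_comp_frameDeriv c hk hchar hu)
  rw [fderiv_comp u (hA.differentiable one_ne_zero _) (c.differentiableAt hu),
    fderiv_comp u (hB.differentiable one_ne_zero _) (c.differentiableAt hu)]
  simp only [ContinuousLinearMap.comp_apply, tangentFrame_apply (S.N) _ (1, 0),
    tangentFrame_apply (S.N) _ (0, 1), one_smul, zero_smul, add_zero, zero_add] at h hD
  rw [bracket, ← h]
  simp only [ContinuousLinearMap.comp_apply, hD]

omit hk in
theorem integral_bracket_eq_zero_of_patch (hk : 2 ≤ k) (P : Patch 2 S.carrier)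
    (hK : IsCompact K) (hKP : K ⊆ S.carrier ∩ P.nhd) (hA : ContDiff ℝ 1 A)
    (h0 : ∀ g ∈ S.carrier \ K, A g = 0) (hB : ContDiff ℝ 2 B) :
    ∫ g in S.carrier, S.bracket A B g ∂hPerimeter S.carrier = 0 := by
  have hk1 : 1 ≤ k := one_le_two.trans hk
  have hB1 : ContDiff ℝ 1 B := hB.of_le one_le_two
  have hmeas := S.measurableSet_carrier
  have hP := P.ae_mem_of_mapsTo hmeas P.mapsTo
  obtain ⟨ε, hε⟩ := exists_hlen_normal_eq_mul_det P.toChart hk1 hchar P.isPreconnected_dom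
  calc ∫ g in S.carrier, S.bracket A B g ∂hPerimeter S.carrier
      = ∫ g in S.carrier ∩ P.nhd, S.bracket A B g ∂hPerimeter S.carrier :=
        setIntegral_eq_of_subset_of_forall_sdiff_eq_zero hmeas inter_subset_left fun g hg =>
          bracket_eq_zero_of_notMem hk1 hchar hK.isClosed hA h0
            ⟨hg.1, fun hgK => hg.2 (hKP hgK)⟩
    _ = ∫ g, S.bracket A B g ∂P.hPerimeter := by
        rw [← Measure.restrict_restrict hmeas, P.restrict_hPerimeter,
          Measure.restrict_eq_self_of_ae_mem hP]
    _ = ∫ u in P.dom, hlen (P.normal u) * S.bracket A B (P.toFun u) := by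
        refine P.integral_hPerimeter ?_
        rw [← Measure.restrict_eq_self_of_ae_mem hP]
        exact (continuousOn_bracket hk1 hchar hA hB1).aestronglyMeasurable hmeas
    _ = ∫ u in P.dom, ε *
          (fderiv ℝ (A ∘ P.toFun) u (1, 0) * fderiv ℝ (B ∘ P.toFun) u (0, 1) -
            fderiv ℝ (A ∘ P.toFun) u (0, 1) * fderiv ℝ (B ∘ P.toFun) u (1, 0)) := by
        refine setIntegral_congr_fun P.isOpen_dom.measurableSet fun u hu => ?_
        simp only [← det_frameDeriv_mul_bracket hk1 hchar P.toChart hu hA hB1, hε u hu, mul_assoc]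
    _ = 0 := by
        rw [integral_const_mul, setIntegral_fderiv_wedge_eq_zero P.isOpen_dom
          (hK.image P.proj.continuous) (image_subset_iff.2 fun x hx => P.proj_mem (hKP hx))
          (hA.comp_contDiffOn P.contDiffOn) (fun u hu => ?_)
          (hB.comp_contDiffOn P.contDiffOn_patch), mul_zero]
        exact h0 _ ⟨P.mapsTo hu.1, fun h => hu.2 ⟨_, h, P.proj_toFun hu.1⟩⟩

omit hk hchar in
theorem exists_patch_decomposition {m : ℕ∞ω} (hm : 1 ≤ m) (hm' : m ≠ ∞) (hk : m ≤ k) {n : ℕ∞}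
    (hK : IsCompact K) (hKS : K ⊆ S.carrier) (hA : ContDiff ℝ n A)
    (h0 : ∀ g ∈ S.carrier \ K, A g = 0) :
    ∃ (t : Finset K) (P : t → Patch m S.carrier) (L : t → Set Heis) (F : t → Heis → ℝ),
      (∀ i, IsCompact (L i)) ∧ (∀ i, L i ⊆ K ∩ (P i).nhd) ∧ (∀ i, ContDiff ℝ n (F i)) ∧
      (∀ i, ∀ g ∈ S.carrier \ L i, F i g = 0) ∧ EqOn A (fun g => ∑ i, F i g) S.carrier := by
  choose P hP using fun (g : Heis) (hg : g ∈ K) => S.exists_patch hm hm' hk (hKS hg)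
  obtain ⟨t, ht⟩ := hK.elim_nhds_subcover' (fun g hg => (P g hg).nhd)
    fun g hg => (P g hg).isOpen_nhd.mem_nhds (hP g hg)
  obtain ⟨f, hf⟩ := SmoothPartitionOfUnity.exists_isSubordinate 𝓘(ℝ, Heis) hK.isClosed
    (fun i : t => (P i i.1.2).nhd) (fun i => (P i i.1.2).isOpen_nhd)
    (by simpa only [iUnion_subtype] using ht)
  refine ⟨t, fun i => P i i.1.2, fun i => K ∩ tsupport (f i), fun i g => f i g * A g,
    fun i => hK.inter_right (isClosed_tsupport _), fun i => inter_subset_inter_right K (hf i),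
    fun i => ((f i).contMDiff.contDiff.of_le (mod_cast le_top)).mul hA, ?_, fun g hg => ?_⟩
  · rintro i g ⟨hg, hgL⟩
    change f i g * A g = 0
    by_cases hgK : g ∈ K
    · rw [image_eq_zero_of_notMem_tsupport fun h => hgL ⟨hgK, h⟩, zero_mul]
    · rw [h0 g ⟨hg, hgK⟩, mul_zero]
  · by_cases hgK : g ∈ K
    · have hsum := f.sum_eq_one hgK
      rw [finsum_eq_sum_of_fintype] at hsum
      simp only [← Finset.sum_mul, hsum, one_mul]
    · simp [h0 g ⟨hg, hgK⟩]

omit hk in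
theorem integral_bracket_eq_zero (hk : 2 ≤ k) (hK : IsCompact K) (hKS : K ⊆ S.carrier)
    (hfin : hPerimeter S.carrier K < ⊤) (hA : ContDiff ℝ 1 A)
    (h0 : ∀ g ∈ S.carrier \ K, A g = 0) (hB : ContDiff ℝ 2 B) :
    ∫ g in S.carrier, S.bracket A B g ∂hPerimeter S.carrier = 0 := by
  have hk1 : 1 ≤ k := one_le_two.trans hk
  obtain ⟨t, P, L, F, hL, hLP, hF, hF0, hAF⟩ :=
    exists_patch_decomposition (n := 1) one_le_two (by decide) hk hK hKS hA h0
  have hLK (i) : L i ⊆ K := (hLP i).trans inter_subset_left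
  have hd {g : Heis} (i) : DifferentiableAt ℝ (F i) g := (hF i).differentiable one_ne_zero g
  have hbracket : EqOn (S.bracket A B) (fun g => ∑ i, S.bracket (F i) B g) S.carrier := by
    intro g hg
    have hdA {v : Heis} (hv : v ∈ S.tangent g) : fderiv ℝ A g v = ∑ i, fderiv ℝ (F i) g v := by
      rw [fderiv_eq_of_eqOn hk1 hg univ_mem (hA.differentiable one_ne_zero g)
        (DifferentiableAt.fun_sum fun i _ => hd i) (fun x hx => hAF hx.1) hv,
        fderiv_fun_sum fun i _ => hd i, sum_apply]
    rw [bracket, hdA (Z_mem_tangent hg), hdA (tanT_mem_tangent hg (hlen_ne_zero hchar hg))]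
    simp only [bracket, Finset.sum_mul, Finset.sum_sub_distrib]
  rw [setIntegral_congr_fun S.measurableSet_carrier hbracket, integral_finsetSum]
  · refine Finset.sum_eq_zero fun i _ => ?_
    exact integral_bracket_eq_zero_of_patch hchar hk (P i) (hL i)
      (fun x hx => ⟨hKS (hLK i hx), (hLP i hx).2⟩) (hF i) (hF0 i) hB
  · exact fun i _ => integrableOn_bracket hk1 hchar hK hKS hfin (hF i)
      (fun g hg => hF0 i g ⟨hg.1, fun h => hg.2 (hLK i h)⟩) (hB.of_le one_le_two)

end OrientedSurface

/-! ### Diffeomorphisms -/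

section Perturbation

variable {E : Type*} [NormedAddCommGroup E] [NormedSpace ℝ E]

theorem exists_homeomorph_add_of_lipschitzWith [CompleteSpace E] {n : ℕ∞ω} (hn : n ≠ 0)
    {η : E → E} (hη : ContDiff ℝ n η) {c : NNReal} (hc : c < 1) (hlip : LipschitzWith c η) :
    ∃ e : E ≃ₜ E, (∀ x, e x = x + η x) ∧ ContDiff ℝ n e.symm := by
  have happ : ApproximatesLinearOn (fun x => x + η x)
      (ContinuousLinearEquiv.refl ℝ E : E →L[ℝ] E) univ c := by
    rw [ApproximatesLinearOn.approximatesLinearOn_iff_lipschitzOnWith]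
    convert hlip.lipschitzOnWith using 1
    ext x
    simp
  have hc' : Subsingleton E ∨ c < ‖((ContinuousLinearEquiv.refl ℝ E).symm : E →L[ℝ] E)‖₊⁻¹ := by
    refine (subsingleton_or_nontrivial E).imp_right fun hE => ?_
    have := EMetric.nontrivial_iff_nontrivialTopology.1 hE
    rwa [ContinuousLinearEquiv.refl_symm, ContinuousLinearEquiv.coe_refl,
      ContinuousLinearMap.nnnorm_id, inv_one]
  have hsmall (x : E) : ‖-fderiv ℝ η x‖ < 1 := by
    rw [norm_neg]
    exact (norm_fderiv_le_of_lipschitz ℝ hlip).trans_lt (mod_cast hc)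
  let D (x : E) : E ≃L[ℝ] E := ContinuousLinearEquiv.ofUnit (Units.oneSub _ (hsmall x))
  have hD (x : E) : HasFDerivAt (fun x => x + η x) (D x : E →L[ℝ] E) x := by
    have hDx : (D x : E →L[ℝ] E) = ContinuousLinearMap.id ℝ E - -fderiv ℝ η x := rfl
    rw [hDx, sub_neg_eq_add]
    exact (hasFDerivAt_id x).add (hη.differentiable hn x).hasFDerivAt
  exact ⟨happ.toHomeomorph _ hc', fun x => rfl,
    Homeomorph.contDiff_symm _ hD (contDiff_id.add hη)⟩

theorem eventually_exists_homeomorph_add_smul [FiniteDimensional ℝ E] {n : ℕ∞ω} (hn : n ≠ 0)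
    {η : E → E} (hη : ContDiff ℝ n η) (hc : HasCompactSupport η) :
    ∀ᶠ s in 𝓝 (0 : ℝ), ∃ e : E ≃ₜ E, (∀ x, e x = x + s • η x) ∧ ContDiff ℝ n e.symm := by
  have : CompleteSpace E := FiniteDimensional.complete ℝ E
  obtain ⟨L, hL⟩ := hη.lipschitzWith_of_hasCompactSupport hc hn
  have hsmall : ∀ᶠ s in 𝓝 (0 : ℝ), ‖s‖₊ * L < 1 := by
    have : Continuous fun s : ℝ => ‖s‖₊ * L := by fun_prop
    exact (this.tendsto 0).eventually_lt_const (by simp)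
  filter_upwards [hsmall] with s hs
  exact exists_homeomorph_add_of_lipschitzWith hn (contDiff_const.smul hη) hs
    ((lipschitzWith_smul s).comp hL)

end Perturbation

/-- The image of a chart under a diffeomorphism of the ambient space. -/
def Chart.push {M M' : Set Heis} (c : Chart M) (e : Heis ≃ₜ Heis) (he : ContDiff ℝ 1 e)
    (he' : ContDiff ℝ 1 e.symm) (hM : MapsTo e M M') : Chart M' where
  dom := c.dom
  toFun u := e (c.toFun u)
  isOpen_dom := c.isOpen_dom
  contDiffOn := he.comp_contDiffOn c.contDiffOn
  injOn _ hu _ hv h := c.injOn hu hv (e.injective h)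
  immersion u hu := by
    have hed := (he.differentiable one_ne_zero (c.toFun u)).hasFDerivAt
    have hinv := (he'.differentiable one_ne_zero (e (c.toFun u))).hasFDerivAt.comp (c.toFun u) hed
    have hleft := (hinv.congr_of_eventuallyEq
      (Eventually.of_forall fun x => (e.symm_apply_apply x).symm)).unique (hasFDerivAt_id _)
    change Function.Injective (fderiv ℝ (e ∘ c.toFun) u)
    rw [(hed.comp u (c.differentiableAt hu).hasFDerivAt).fderiv, ContinuousLinearMap.coe_comp]
    exact Function.Injective.comp (Function.LeftInverse.injective
      (g := fderiv ℝ e.symm (e (c.toFun u))) (DFunLike.congr_fun hleft)) (c.immersion u hu)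
  mapsTo _ hu := hM (c.mapsTo hu)

theorem withDensity_mono_left {α : Type*} [MeasurableSpace α] {μ ν : Measure α} (h : μ ≤ ν)
    (f : α → ENNReal) : μ.withDensity f ≤ ν.withDensity f := by
  refine Measure.le_iff.2 fun s hs => ?_
  rw [withDensity_apply _ hs, withDensity_apply _ hs]
  exact lintegral_mono' (Measure.restrict_mono_measure h s) le_rfl

section Image

variable {M : Set Heis} {e : Heis ≃ₜ Heis} {he : ContDiff ℝ 1 e} {he' : ContDiff ℝ 1 e.symm}
  {J : Heis → ENNReal}

theorem Chart.push_push_symm {M' : Set Heis} (c : Chart M') (hM : MapsTo e.symm M' M)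
    (hM' : MapsTo e M M') : (c.push e.symm he' he hM).push e he he' hM' = c := by
  cases c
  simp [Chart.push]

theorem Chart.hPerimeter_push {M' : Set Heis} (c : Chart M) (hM : MapsTo e M M')
    (hJ : Measurable J)
    (h : ∀ u ∈ c.dom, ENNReal.ofReal (hlen ((c.push e he he' hM).normal u)) =
      ENNReal.ofReal (hlen (c.normal u)) * J (c.toFun u)) :
    (c.push e he he' hM).hPerimeter = (c.hPerimeter.withDensity J).map e := by
  ext B hB
  have hB' := e.continuous.measurable hB
  rw [Chart.hPerimeter_apply _ hB, Measure.map_apply e.continuous.measurable hB,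
    withDensity_apply _ hB', c.setLIntegral_hPerimeter hB' hJ]
  exact setLIntegral_congr_fun (c.measurableSet_inter_preimage hB') fun u hu => h u hu.1

/-- The function `J` is the Jacobian of the diffeomorphism `e` of the ambient space with respect
to the `H`-perimeter measures of `M` and of its image. -/
structure IsHJacobian (M : Set Heis) (e : Heis ≃ₜ Heis) (he : ContDiff ℝ 1 e)
    (he' : ContDiff ℝ 1 e.symm) (J : Heis → ENNReal) : Prop where
  measurable : Measurable J
  ne_zero : ∀ g, J g ≠ 0
  ne_top : ∀ g, J g ≠ ⊤
  hlen_normal_push : ∀ c : Chart M, ∀ u ∈ c.dom,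
    ENNReal.ofReal (hlen ((c.push e he he' (mapsTo_image e M)).normal u)) =
      ENNReal.ofReal (hlen (c.normal u)) * J (c.toFun u)

namespace IsHJacobian

theorem hPerimeter_push (h : IsHJacobian M e he he' J) (c : Chart M) :
    (c.push e he he' (mapsTo_image e M)).hPerimeter = (c.hPerimeter.withDensity J).map e :=
  c.hPerimeter_push _ h.measurable (h.hlen_normal_push c)

theorem hPerimeter_image_le (h : IsHJacobian M e he he' J) :
    hPerimeter (e '' M) ≤ ((hPerimeter M).withDensity J).map e := by
  refine iSup_le fun c => ?_
  have hM : MapsTo e.symm (e '' M) M := by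
    rintro _ ⟨x, hx, rfl⟩
    rwa [e.symm_apply_apply]
  rw [← c.push_push_symm (he := he) (he' := he') hM (mapsTo_image e M), h.hPerimeter_push]
  exact Measure.map_mono (withDensity_mono_left (le_iSup (Chart.hPerimeter (M := M)) _) _)
    e.continuous.measurable

theorem withDensity_hPerimeter_le (h : IsHJacobian M e he he' J) :
    (hPerimeter M).withDensity J ≤ (hPerimeter (e '' M)).map e.symm := by
  set ν := (hPerimeter (e '' M)).map e.symm
  have hchart (c : Chart M) : c.hPerimeter.withDensity J ≤ ν := by
    have hmap : c.hPerimeter.withDensity J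
        = (c.push e he he' (mapsTo_image e M)).hPerimeter.map e.symm := by
      rw [h.hPerimeter_push, Measure.map_map e.symm.continuous.measurable e.continuous.measurable,
        e.symm_comp_self, Measure.map_id]
    rw [hmap]
    exact Measure.map_mono (le_iSup (Chart.hPerimeter (M := e '' M)) _)
      e.symm.continuous.measurable
  have hle : hPerimeter M ≤ ν.withDensity J⁻¹ := iSup_le fun c => by
    rw [← withDensity_inv_same (μ := c.hPerimeter) h.measurable (.of_forall h.ne_zero)
      (.of_forall h.ne_top)]
    exact withDensity_mono_left (hchart c) _
  calc (hPerimeter M).withDensity J ≤ (ν.withDensity J⁻¹).withDensity J⁻¹⁻¹ := by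
        rw [inv_inv]
        exact withDensity_mono_left hle _
    _ = ν := withDensity_inv_same h.measurable.inv
        (.of_forall fun g => ENNReal.inv_ne_zero.2 (h.ne_top g))
        (.of_forall fun g => ENNReal.inv_ne_top.2 (h.ne_zero g))

theorem hPerimeter_image (h : IsHJacobian M e he he' J) {B : Set Heis} (hB : MeasurableSet B) :
    hPerimeter (e '' M) (e '' B) = ∫⁻ g in B, J g ∂hPerimeter M := by
  rw [← withDensity_apply _ hB]
  apply le_antisymm
  · refine (h.hPerimeter_image_le _).trans_eq ?_
    rw [e.measurableEmbedding.map_apply, e.preimage_image]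
  · refine (h.withDensity_hPerimeter_le _).trans_eq ?_
    rw [Measure.map_apply e.symm.continuous.measurable hB, ← e.image_eq_preimage_symm B]

end IsHJacobian

end Image

/-! ### Second derivatives of integrals -/

theorem HasSecondDerivAt.const_add_congr {V V₁ : ℝ → ℝ} {d x : ℝ} (r : ℝ)
    (h : HasSecondDerivAt V d x) (heq : ∀ᶠ s in 𝓝 x, V₁ s = r + V s) :
    HasSecondDerivAt V₁ d x := by
  obtain ⟨V', hV, hV'⟩ := h
  refine ⟨V', ?_, hV'⟩
  filter_upwards [hV, heq.eventually_nhds] with s hs hs'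
  exact (hs.const_add r).congr_of_eventuallyEq hs'

section Norm

variable {F : Type*} [NormedAddCommGroup F] [InnerProductSpace ℝ F] {v v' : ℝ → F} {w : F} {s : ℝ}

theorem hasDerivAt_norm_of_ne_zero (hv : HasDerivAt v w s) (h0 : v s ≠ 0) :
    HasDerivAt (fun s => ‖v s‖) (⟪v s, w⟫ / ‖v s‖) s := by
  have := hv.norm_sq.sqrt (by simpa using h0)
  simpa [Real.sqrt_sq, mul_div_mul_left] using this

theorem hasDerivAt_inner_div_norm (hv : HasDerivAt v (v' s) s) (hv' : HasDerivAt v' w s)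
    (h0 : v s ≠ 0) :
    HasDerivAt (fun s => ⟪v s, v' s⟫ / ‖v s‖)
      ((‖v' s‖ ^ 2 + ⟪v s, w⟫) / ‖v s‖ - ⟪v s, v' s⟫ ^ 2 / ‖v s‖ ^ 3) s := by
  have hne : ‖v s‖ ≠ 0 := norm_ne_zero_iff.2 h0
  refine ((hv.inner ℝ hv').fun_div (hasDerivAt_norm_of_ne_zero hv h0) hne).congr_deriv ?_
  rw [real_inner_self_eq_norm_sq]
  field_simp
  ring

end Norm

theorem exists_isCompact_nhds_forall_ne_zero {X E : Type*} [TopologicalSpace X]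
    [TopologicalSpace E] [T1Space E] [Zero E] {v : ℝ → X → E} {K : Set X} {x : ℝ} (hK : IsCompact K)
    (hv : ContinuousOn (fun z : ℝ × X => v z.1 z.2) (univ ×ˢ K)) (h0 : ∀ g ∈ K, v x g ≠ 0) :
    ∃ I, IsCompact I ∧ I ∈ 𝓝 x ∧ ∀ s ∈ I, ∀ g ∈ K, v s g ≠ 0 := by
  have hev : ∀ᶠ s in 𝓝 x, ∀ g ∈ K, g ∈ K → v s g ≠ 0 := by
    refine hK.eventually_forall_of_forall_eventually fun g hg => ?_
    have := (hv (x, g) ⟨mem_univ x, hg⟩).eventually_ne (h0 g hg)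
    filter_upwards [eventually_nhdsWithin_iff.1 this] with z hz hzK using hz ⟨mem_univ _, hzK⟩
  obtain ⟨I, hI, hIsub, hIc⟩ := local_compact_nhds hev
  exact ⟨I, hIc, hI, fun s hs g hg => hIsub hs g hg hg⟩

section Integral

variable {X : Type*} [TopologicalSpace X] [T2Space X] [MeasurableSpace X]
  [OpensMeasurableSpace X] {μ : Measure X} {K : Set X} {I : Set ℝ} {x : ℝ}

theorem hasDerivAt_setIntegral_of_isCompact {E : Type*} [NormedAddCommGroup E] [NormedSpace ℝ E]
    {f f' : ℝ → X → E} (hK : IsCompact K) (hμ : μ K < ⊤) (hI : IsCompact I) (hx : I ∈ 𝓝 x)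
    (hf : ContinuousOn (fun z : ℝ × X => f z.1 z.2) (I ×ˢ K))
    (hf' : ContinuousOn (fun z : ℝ × X => f' z.1 z.2) (I ×ˢ K))
    (hd : ∀ s ∈ I, ∀ g ∈ K, HasDerivAt (fun s => f s g) (f' s g) s) :
    HasDerivAt (fun s => ∫ g in K, f s g ∂μ) (∫ g in K, f' x g ∂μ) x := by
  have hslice {φ : ℝ → X → E} (hφ : ContinuousOn (fun z : ℝ × X => φ z.1 z.2) (I ×ˢ K)) {s : ℝ}
      (hs : s ∈ I) : IntegrableOn (φ s) K μ :=
    (hφ.comp (continuousOn_const.prodMk continuousOn_id)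
      fun _ hg => ⟨hs, hg⟩).integrableOn_of_subset_isCompact hK hK.measurableSet subset_rfl hμ.ne
  obtain ⟨C, hC⟩ := (hI.prod hK).exists_bound_of_continuousOn hf'
  have hxI := mem_of_mem_nhds hx
  refine (hasDerivAt_integral_of_dominated_loc_of_deriv_le (bound := fun _ => C) hx
    (eventually_of_mem hx fun s hs => (hslice hf hs).aestronglyMeasurable) (hslice hf hxI)
    (hslice hf' hxI).aestronglyMeasurable ?_ (integrableOn_const hμ.ne) ?_).2
  · exact ae_restrict_of_forall_mem hK.measurableSet fun g hg s hs => hC (s, g) ⟨hs, hg⟩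
  · exact ae_restrict_of_forall_mem hK.measurableSet fun g hg s hs => hd s hs g hg

theorem hasSecondDerivAt_setIntegral_of_isCompact {f f' f'' : ℝ → X → ℝ} (hK : IsCompact K)
    (hμ : μ K < ⊤) (hI : IsCompact I) (hx : I ∈ 𝓝 x)
    (hf : ContinuousOn (fun z : ℝ × X => f z.1 z.2) (I ×ˢ K))
    (hf' : ContinuousOn (fun z : ℝ × X => f' z.1 z.2) (I ×ˢ K))
    (hf'' : ContinuousOn (fun z : ℝ × X => f'' z.1 z.2) (I ×ˢ K))
    (hd : ∀ s ∈ I, ∀ g ∈ K, HasDerivAt (fun s => f s g) (f' s g) s)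
    (hd' : ∀ s ∈ I, ∀ g ∈ K, HasDerivAt (fun s => f' s g) (f'' s g) s) :
    HasSecondDerivAt (fun s => ∫ g in K, f s g ∂μ) (∫ g in K, f'' x g ∂μ) x :=
  ⟨fun s => ∫ g in K, f' s g ∂μ,
    (eventually_mem_nhds_iff.2 hx).mono fun _ hs =>
      hasDerivAt_setIntegral_of_isCompact hK hμ hI hs hf hf' hd,
    hasDerivAt_setIntegral_of_isCompact hK hμ hI hx hf' hf'' hd'⟩

theorem hasSecondDerivAt_setIntegral_norm {F : Type*} [NormedAddCommGroup F]
    [InnerProductSpace ℝ F] {v v' v'' : ℝ → X → F} (hK : IsCompact K) (hμ : μ K < ⊤)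
    (hv : ContinuousOn (fun z : ℝ × X => v z.1 z.2) (univ ×ˢ K))
    (hv' : ContinuousOn (fun z : ℝ × X => v' z.1 z.2) (univ ×ˢ K))
    (hv'' : ContinuousOn (fun z : ℝ × X => v'' z.1 z.2) (univ ×ˢ K))
    (hd : ∀ s, ∀ g ∈ K, HasDerivAt (fun s => v s g) (v' s g) s)
    (hd' : ∀ s, ∀ g ∈ K, HasDerivAt (fun s => v' s g) (v'' s g) s)
    (h0 : ∀ g ∈ K, v x g ≠ 0) :
    HasSecondDerivAt (fun s => ∫ g in K, ‖v s g‖ ∂μ)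
      (∫ g in K, ((‖v' x g‖ ^ 2 + ⟪v x g, v'' x g⟫) / ‖v x g‖
        - ⟪v x g, v' x g⟫ ^ 2 / ‖v x g‖ ^ 3) ∂μ) x := by
  obtain ⟨I, hI, hxI, hne⟩ := exists_isCompact_nhds_forall_ne_zero hK hv h0
  have hsub : I ×ˢ K ⊆ univ ×ˢ K := prod_mono_left (subset_univ I)
  replace hv := hv.mono hsub
  replace hv' := hv'.mono hsub
  replace hv'' := hv''.mono hsub
  have hne' (z : ℝ × X) (hz : z ∈ I ×ˢ K) : ‖v z.1 z.2‖ ≠ 0 :=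
    norm_ne_zero_iff.2 (hne _ hz.1 _ hz.2)
  exact hasSecondDerivAt_setIntegral_of_isCompact hK hμ hI hxI hv.norm
    ((hv.inner hv').div hv.norm hne')
    ((((hv'.norm.pow 2).add (hv.inner hv'')).div hv.norm hne').sub
      (((hv.inner hv').pow 2).div (hv.norm.pow 3) fun z hz => pow_ne_zero 3 (hne' z hz)))
    (fun s hs g hg => hasDerivAt_norm_of_ne_zero (hd s g hg) (hne s hs g hg))
    fun s hs g hg => hasDerivAt_inner_div_norm (hd s g hg) (hd' s g hg) (hne s hs g hg)

end Integral

/-! ### The normal of the deformed surface -/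

section VariationField

variable {a b : Heis → ℝ}

/-- The horizontal field `a X₁ + b X₂`. -/
def horizontalField (a b : Heis → ℝ) (g : Heis) : Heis := a g • X₁ g + b g • X₂ g

theorem contDiff_horizontalField {k : ℕ∞ω} (ha : ContDiff ℝ k a) (hb : ContDiff ℝ k b) :
    ContDiff ℝ k (horizontalField a b) :=
  (ha.smul (contDiff_X₁ k)).add (hb.smul (contDiff_X₂ k))

theorem hasCompactSupport_horizontalField (ha : HasCompactSupport a) (hb : HasCompactSupport b) :
    HasCompactSupport (horizontalField a b) :=
  ha.smul_right.add hb.smul_right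

theorem coords_fderiv_add_smul_horizontalField {g : Heis} (ha : DifferentiableAt ℝ a g)
    (hb : DifferentiableAt ℝ b g) (s : ℝ) (v : Heis) :
    coords (g + s • horizontalField a b g)
        (fderiv ℝ (fun x => x + s • horizontalField a b x) g v) =
      ![v.1 + s * fderiv ℝ a g v, v.2.1 + s * fderiv ℝ b g v,
        coords g v 2 + s * (b g * v.1 - a g * v.2.1)
          + s ^ 2 / 2 * (b g * fderiv ℝ a g v - a g * fderiv ℝ b g v)] := by
  have hx : HasFDerivAt (fun x : Heis => x.1) (.fst ℝ ℝ (ℝ × ℝ)) g := hasFDerivAt_fst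
  have hy : HasFDerivAt (fun x : Heis => x.2.1) ((ContinuousLinearMap.fst ℝ ℝ ℝ).comp
    (.snd ℝ ℝ (ℝ × ℝ))) g := hasFDerivAt_snd.fst
  have ht : HasFDerivAt (fun x : Heis => x.2.2) ((ContinuousLinearMap.snd ℝ ℝ ℝ).comp
    (.snd ℝ ℝ (ℝ × ℝ))) g := hasFDerivAt_snd.snd
  have hcomponents := (hx.fun_add (ha.hasFDerivAt.const_mul s)).prodMk
    ((hy.fun_add (hb.hasFDerivAt.const_mul s)).prodMk (ht.fun_add
      (((hx.fun_mul hb.hasFDerivAt).fun_sub (hy.fun_mul ha.hasFDerivAt)).const_mul (s / 2))))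
  have hfun : (fun x => x + s • horizontalField a b x) = fun x => (x.1 + s * a x,
      x.2.1 + s * b x, x.2.2 + s / 2 * (x.1 * b x - x.2.1 * a x)) := by
    funext x
    ext <;> simp [horizontalField, X₁, X₂]
    ring
  rw [hfun, hcomponents.fderiv]
  ext i
  fin_cases i
  · simp [coords]
  · simp [coords]
  · simp [coords, horizontalField, X₁, X₂]; ring

end VariationField

theorem hlen_crossProduct (v w : Fin 3 → ℝ) :
    hlen (crossProduct v w) = ‖w 2 • !₂[v 0, v 1] - v 2 • !₂[w 0, w 1]‖ := by
  simp only [hlen, cross_apply, EuclideanSpace.norm_eq, Fin.sum_univ_two]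
  simp
  ring_nf

namespace OrientedSurface

variable {k : ℕ∞ω} (S : OrientedSurface k) (h a b : Heis → ℝ)

/-- The fields `a X₁ + b X₂` that extend `h ν_H` to a `C¹` field with compact support. -/
structure IsNormalVariation : Prop where
  contDiff_fst : ContDiff ℝ 1 a
  contDiff_snd : ContDiff ℝ 1 b
  hasCompactSupport_fst : HasCompactSupport a
  hasCompactSupport_snd : HasCompactSupport b
  fst_eq : ∀ g ∈ S.carrier, a g = h g * pbar S.N g
  snd_eq : ∀ g ∈ S.carrier, b g = h g * qbar S.N g

/-- The coefficients `x₀, x₁, x₂, x₃` of the cubic polynomial in `s` that the horizontal part of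
the normal `ψ_s(Z) × ψ_s(T - ω̄ Y)` of the deformed surface is, up to a quarter turn, where `ψ_s`
is the derivative of the displacement by `s (a X₁ + b X₂)`. -/
def normalCoeff (g : Heis) : Fin 4 → EuclideanSpace ℝ (Fin 2) :=
  let ν := !₂[pbar S.N g, qbar S.N g]
  let ζ := !₂[qbar S.N g, -pbar S.N g]
  let α := !₂[fderiv ℝ a g (Z S.N g), fderiv ℝ b g (Z S.N g)]
  let β := !₂[fderiv ℝ a g (tanT S.N g), fderiv ℝ b g (tanT S.N g)]
  let κ (v : Heis) := (b g * fderiv ℝ a g v - a g * fderiv ℝ b g v) / 2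
  ![ζ, α + (h g * ombar S.N g) • ν,
    κ (tanT S.N g) • ζ - h g • β + (κ (Z S.N g) * ombar S.N g) • ν,
    κ (tanT S.N g) • α - κ (Z S.N g) • β]

/-- The cubic polynomial with coefficients `S.normalCoeff h a b g`. Its length is the Jacobian of
the displacement by `s (a X₁ + b X₂)` for the `H`-perimeter measure. -/
def deformedNormal (s : ℝ) (g : Heis) : EuclideanSpace ℝ (Fin 2) :=
  ∑ i : Fin 4, s ^ (i : ℕ) • S.normalCoeff h a b g i

variable {S h a b} {g : Heis}

theorem hlen_crossProduct_push_frame (hab : S.IsNormalVariation h a b) (hg : g ∈ S.carrier)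
    (hW : hlen (S.N g) ≠ 0) (s : ℝ) :
    hlen (crossProduct
      (coords (g + s • horizontalField a b g)
        (fderiv ℝ (fun x => x + s • horizontalField a b x) g (Z S.N g)))
      (coords (g + s • horizontalField a b g)
        (fderiv ℝ (fun x => x + s • horizontalField a b x) g (tanT S.N g)))) =
      ‖S.deformedNormal h a b s g‖ := by
  have hda := hab.contDiff_fst.differentiable one_ne_zero g
  have hdb := hab.contDiff_snd.differentiable one_ne_zero g
  have hZ : b g * qbar S.N g + a g * pbar S.N g = h g := by
    rw [hab.fst_eq g hg, hab.snd_eq g hg]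
    linear_combination h g * pbar_sq_add_qbar_sq hW
  have hT : a g * qbar S.N g - b g * pbar S.N g = 0 := by
    rw [hab.fst_eq g hg, hab.snd_eq g hg]
    ring
  rw [hlen_crossProduct, coords_fderiv_add_smul_horizontalField hda hdb,
    coords_fderiv_add_smul_horizontalField hda hdb, coords_Z, coords_tanT]
  congr 1
  ext i
  fin_cases i <;>
  simp only [deformedNormal, normalCoeff, Fin.sum_univ_four, Z_fst, Z_snd_fst, tanT_fst,
    tanT_snd_fst, Nat.succ_eq_add_one, Nat.reduceAdd, Fin.isValue, Fin.zero_eta, Fin.mk_one,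
    Fin.coe_ofNat_eq_mod, Nat.zero_mod, Nat.one_mod, Nat.reduceMod, Nat.mod_succ,
    Matrix.cons_val, Matrix.cons_val_zero, Matrix.cons_val_one, Matrix.cons_val_fin_one,
    PiLp.add_apply, PiLp.sub_apply, PiLp.smul_apply, smul_eq_mul, mul_neg, pow_zero, pow_one,
    one_smul]
  · linear_combination (s * ombar S.N g * (qbar S.N g + s * fderiv ℝ a g (Z S.N g))) * hT
      + s * (ombar S.N g * pbar S.N g - s * fderiv ℝ a g (tanT S.N g)) * hZ
  · linear_combination (s * ombar S.N g * (s * fderiv ℝ b g (Z S.N g) - pbar S.N g)) * hT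
      + s * (ombar S.N g * qbar S.N g - s * fderiv ℝ b g (tanT S.N g)) * hZ

variable (hk : 1 ≤ k) (hchar : S.charLocus = ∅)
include hk hchar

theorem hlen_normal_push (hab : S.IsNormalVariation h a b) {s : ℝ} {e : Heis ≃ₜ Heis}
    (hes : ∀ g, e g = g + s • horizontalField a b g) (he : ContDiff ℝ 1 e)
    (he' : ContDiff ℝ 1 e.symm) {M : Set Heis} (hM : MapsTo e S.carrier M) (c : Chart S.carrier)
    {u : ℝ × ℝ} (hu : u ∈ c.dom) :
    hlen ((c.push e he he' hM).normal u) =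
      hlen (c.normal u) * ‖S.deformedNormal h a b s (c.toFun u)‖ := by
  have hg := c.mapsTo hu
  have hfderiv : fderiv ℝ (c.push e he he' hM).toFun u =
      (fderiv ℝ e (c.toFun u)).comp ((tangentFrame S.N (c.toFun u)).comp (S.frameDeriv c u)) := by
    rw [tangentFrame_comp_frameDeriv c hk hchar hu]
    exact fderiv_comp u (he.differentiable one_ne_zero _) (c.differentiableAt hu)
  have hframe := crossProduct_comp_eq_det_smul (S.frameDeriv c u) ((coordsL (e (c.toFun u))).comp
    ((fderiv ℝ e (c.toFun u)).comp (tangentFrame S.N (c.toFun u))))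
  simp only [ContinuousLinearMap.comp_apply, coordsL_apply] at hframe
  have hlen_frame := hlen_crossProduct_push_frame hab hg (hlen_ne_zero hchar hg) s
  rw [← funext hes, ← hes] at hlen_frame
  rw [hlen_normal_eq_abs_det c hk hchar hu, ← hlen_frame, ← hlen_smul, Chart.normal, hfderiv]
  change hlen (crossProduct (coords (e (c.toFun u)) _) (coords (e (c.toFun u)) _)) = _
  simp only [ContinuousLinearMap.comp_apply]
  rw [hframe]
  simp [tangentFrame_apply]

theorem continuousOn_normalCoeff (hh : ContinuousOn h S.carrier) (ha : ContDiff ℝ 1 a)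
    (hb : ContDiff ℝ 1 b) (i : Fin 4) :
    ContinuousOn (fun g => S.normalCoeff h a b g i) S.carrier := by
  have hp : ContinuousOn (pbar S.N) S.carrier := continuousOn_N_div_hlen hk hchar 0
  have hq : ContinuousOn (qbar S.N) S.carrier := continuousOn_N_div_hlen hk hchar 1
  have hω : ContinuousOn (ombar S.N) S.carrier := continuousOn_N_div_hlen hk hchar 2
  have haZ := continuousOn_fderiv_Z hk hchar ha
  have haT := continuousOn_fderiv_tanT hk hchar ha
  have hbZ := continuousOn_fderiv_Z hk hchar hb
  have hbT := continuousOn_fderiv_tanT hk hchar hb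
  have hvec {f₁ f₂ : Heis → ℝ} (h₁ : ContinuousOn f₁ S.carrier) (h₂ : ContinuousOn f₂ S.carrier) :
      ContinuousOn (fun g => !₂[f₁ g, f₂ g]) S.carrier := by fun_prop
  have hκ {f₁ f₂ : Heis → ℝ} (h₁ : ContinuousOn f₁ S.carrier) (h₂ : ContinuousOn f₂ S.carrier) :
      ContinuousOn (fun g => (b g * f₁ g - a g * f₂ g) / 2) S.carrier :=
    ((hb.continuous.continuousOn.mul h₁).sub (ha.continuous.continuousOn.mul h₂)).div_const 2
  fin_cases i
  · exact hvec hq hp.neg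
  · exact (hvec haZ hbZ).add ((hh.mul hω).smul (hvec hp hq))
  · exact (((hκ haT hbT).smul (hvec hq hp.neg)).sub (hh.smul (hvec haT hbT))).add
      (((hκ haZ hbZ).mul hω).smul (hvec hp hq))
  · exact ((hκ haT hbT).smul (hvec haZ hbZ)).sub ((hκ haZ hbZ).smul (hvec haT hbT))

omit hk in
theorem norm_normalCoeff_zero (hg : g ∈ S.carrier) : ‖S.normalCoeff h a b g 0‖ = 1 := by
  simp [normalCoeff, EuclideanSpace.norm_eq, Fin.sum_univ_two, add_comm (qbar S.N g ^ 2),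
    pbar_sq_add_qbar_sq (hlen_ne_zero hchar hg)]

theorem norm_deformedNormal_of_notMem (hab : S.IsNormalVariation h a b) {K : Set Heis}
    (hK : IsClosed K) (hsupp : ∀ g ∈ S.carrier \ K, h g = 0) (s : ℝ) (hg : g ∈ S.carrier \ K) :
    ‖S.deformedNormal h a b s g‖ = 1 := by
  have ha0 : ∀ g ∈ S.carrier \ K, a g = 0 := fun g hg => by
    rw [hab.fst_eq g hg.1, hsupp g hg, zero_mul]
  have hb0 : ∀ g ∈ S.carrier \ K, b g = 0 := fun g hg => by
    rw [hab.snd_eq g hg.1, hsupp g hg, zero_mul]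
  have hda {v : Heis} (hv : v ∈ S.tangent g) : fderiv ℝ a g v = 0 :=
    fderiv_eq_zero_of_mem_tangent hk hK (hab.contDiff_fst.differentiable one_ne_zero g) ha0 hg hv
  have hdb {v : Heis} (hv : v ∈ S.tangent g) : fderiv ℝ b g v = 0 :=
    fderiv_eq_zero_of_mem_tangent hk hK (hab.contDiff_snd.differentiable one_ne_zero g) hb0 hg hv
  have hZ := Z_mem_tangent hg.1
  have hT := tanT_mem_tangent hg.1 (hlen_ne_zero hchar hg.1)
  rw [← norm_normalCoeff_zero (h := h) (a := a) (b := b) hchar hg.1]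
  congr 1
  ext i
  fin_cases i <;> simp [deformedNormal, Fin.sum_univ_four, normalCoeff, hda hZ, hda hT, hdb hZ,
    hdb hT, hsupp g hg]

end OrientedSurface

/-! ### Extensions of the horizontal Gauss map -/

section Extension

variable {E : Type*} [NormedAddCommGroup E] [NormedSpace ℝ E] [FiniteDimensional ℝ E]

theorem exists_contDiff_extension {n : ℕ} {M K : Set E} (hK : IsCompact K) {F : E → ℝ}
    (h0 : ∀ x ∈ M \ K, F x = 0)
    (hloc : ∀ x ∈ K, ∃ f : E → ℝ, ContDiffAt ℝ n f x ∧ ∀ᶠ y in 𝓝 x, y ∈ M → f y = F y) :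
    ∃ f : E → ℝ, ContDiff ℝ n f ∧ HasCompactSupport f ∧ ∀ x ∈ M, f x = F x := by
  have hconvex (x : E) : Convex ℝ {y : ℝ | x ∈ M → y = F x} := by
    by_cases hx : x ∈ M <;> simp [hx, convex_univ]
  obtain ⟨f, hf⟩ := exists_contMDiffMap_forall_mem_convex_of_local (n := n) 𝓘(ℝ, E) hconvex
    fun x => by
      by_cases hx : x ∈ K
      · obtain ⟨f, hf, hfF⟩ := hloc x hx
        obtain ⟨U, hU, hfU⟩ := hf.contDiffOn le_rfl (by simp)
        exact ⟨U ∩ {y | y ∈ M → f y = F y}, inter_mem hU hfF, f,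
          (hfU.mono inter_subset_left).contMDiffOn, fun y hy => hy.2⟩
      · exact ⟨Kᶜ, hK.isClosed.isOpen_compl.mem_nhds hx, fun _ => 0, contMDiffOn_const,
          fun y hy hyM => (h0 y ⟨hyM, hy⟩).symm⟩
  obtain ⟨L, hL, hKL⟩ := exists_compact_superset hK
  obtain ⟨χ, hχK, hχL, -⟩ := exists_contMDiffMap_one_nhds_of_subset_interior (n := n)
    𝓘(ℝ, E) hK.isClosed hKL
  refine ⟨fun x => χ x * f x, χ.contMDiff.contDiff.mul f.contMDiff.contDiff,
    HasCompactSupport.intro hL fun x hx => by rw [hχL x hx, zero_mul], fun x hx => ?_⟩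
  have hfx : f x = F x := hf x hx
  by_cases hxK : x ∈ K
  · simp only [hfx, hχK.self_of_nhdsSet x hxK, one_mul]
  · simp only [hfx, h0 x ⟨hx, hxK⟩, mul_zero]

end Extension

theorem calA_sub_ombar_sq (n : Heis → Fin 3 → ℝ) (g : Heis) :
    calA n g - ombar n g ^ 2 = pbar n g * fderiv ℝ (qbar n) g (tanT n g)
      - qbar n g * fderiv ℝ (pbar n) g (tanT n g) := by
  simp only [calA, twistT, twistY, along, tanT, map_sub, map_smul, smul_eq_mul]
  ring

theorem pbar_mul_fderiv_add_qbar_mul_fderiv {n : Heis → Fin 3 → ℝ} {g : Heis}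
    (hn : ContDiffAt ℝ 1 n g) (hW : hlen (n g) ≠ 0) (v : Heis) :
    pbar n g * fderiv ℝ (pbar n) g v + qbar n g * fderiv ℝ (qbar n) g v = 0 := by
  have hp := ((contDiffAt_pbar hn hW).differentiableAt one_ne_zero).hasFDerivAt
  have hq := ((contDiffAt_qbar hn hW).differentiableAt one_ne_zero).hasFDerivAt
  have hunit : (fun x => pbar n x ^ 2 + qbar n x ^ 2) =ᶠ[𝓝 g] fun _ => 1 := by
    filter_upwards [(continuous_hlen.continuousAt.comp hn.continuousAt).eventually_ne hW] with x hx
    exact pbar_sq_add_qbar_sq hx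
  have hzero := DFunLike.congr_fun (((hp.pow 2).add (hq.pow 2)).unique
    ((hasFDerivAt_const (1 : ℝ) g).congr_of_eventuallyEq hunit)) v
  simp only [add_apply, smul_apply, smul_eq_mul, zero_apply, Nat.cast_ofNat,
    Nat.add_one_sub_one, pow_one, nsmul_eq_mul] at hzero
  linarith

namespace OrientedSurface

variable {k : ℕ∞ω} {S : OrientedSurface k} {h a b : Heis → ℝ} {g : Heis}

theorem eventually_normalNear_eq (hg : g ∈ S.carrier) :
    ∀ᶠ x in 𝓝 g, x ∈ S.carrier → S.normalNear g x = S.N x := by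
  obtain ⟨O, hgO, hO⟩ := S.defining_spec hg
  filter_upwards [hO.isOpen.mem_nhds hgO] with x hx hxS using (hO.normal_eq x ⟨hxS, hx⟩).symm

theorem contDiffAt_normalNear (hk : 2 ≤ k) (hg : g ∈ S.carrier) :
    ContDiffAt ℝ 1 (S.normalNear g) g := by
  obtain ⟨O, hgO, hO⟩ := S.defining_spec hg
  exact (contDiffOn_grad hO.isOpen hO.contDiffOn (one_add_one_eq_two.trans_le hk)).contDiffAt
    (hO.isOpen.mem_nhds hgO)

theorem pbar_normalNear_self (hg : g ∈ S.carrier) :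
    pbar (S.normalNear g) g = pbar S.N g := by
  rw [pbar, normalNear_self hg, pbar]

theorem qbar_normalNear_self (hg : g ∈ S.carrier) :
    qbar (S.normalNear g) g = qbar S.N g := by
  rw [qbar, normalNear_self hg, qbar]

theorem ombar_normalNear_self (hg : g ∈ S.carrier) :
    ombar (S.normalNear g) g = ombar S.N g := by
  rw [ombar, normalNear_self hg, ombar]

theorem tanT_normalNear_self (hg : g ∈ S.carrier) :
    tanT (S.normalNear g) g = tanT S.N g := by
  rw [tanT, Y, pbar_normalNear_self hg, qbar_normalNear_self hg, ombar_normalNear_self hg, tanT, Y]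

theorem integrand_eq_integrand' (hg : g ∈ S.carrier) : S.integrand h g = S.integrand' h g := by
  rw [integrand, integrand', OrientedSurface.calA, Heis.calA, ombar_normalNear_self hg]
  ring

section NonCharacteristic

variable (hk : 2 ≤ k) (hchar : S.charLocus = ∅)
include hk hchar

theorem exists_isNormalVariation {K : Set Heis} (hh : ContDiff ℝ 1 h) (hK : IsCompact K)
    (hKS : K ⊆ S.carrier) (hsupp : ∀ g ∈ S.carrier \ K, h g = 0) :
    ∃ a b, S.IsNormalVariation h a b := by
  have hW {g : Heis} (hg : g ∈ S.carrier) : hlen (S.normalNear g g) ≠ 0 := by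
    rw [normalNear_self hg]
    exact hlen_ne_zero hchar hg
  obtain ⟨a, ha, hac, haS⟩ := exists_contDiff_extension (n := 1) (M := S.carrier) hK
    (F := fun g => h g * pbar S.N g) (fun g hg => by rw [hsupp g hg, zero_mul]) fun g hg =>
      ⟨fun x => h x * pbar (S.normalNear g) x, hh.contDiffAt.mul
        (contDiffAt_pbar (contDiffAt_normalNear hk (hKS hg)) (hW (hKS hg))),
        (eventually_normalNear_eq (hKS hg)).mono fun x hx hxS => by simp only [pbar, hx hxS]⟩
  obtain ⟨b, hb, hbc, hbS⟩ := exists_contDiff_extension (n := 1) (M := S.carrier) hK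
    (F := fun g => h g * qbar S.N g) (fun g hg => by rw [hsupp g hg, zero_mul]) fun g hg =>
      ⟨fun x => h x * qbar (S.normalNear g) x, hh.contDiffAt.mul
        (contDiffAt_qbar (contDiffAt_normalNear hk (hKS hg)) (hW (hKS hg))),
        (eventually_normalNear_eq (hKS hg)).mono fun x hx hxS => by simp only [qbar, hx hxS]⟩
  exact ⟨a, b, ha, hb, hac, hbc, haS, hbS⟩

end NonCharacteristic

end OrientedSurface

/-! ### The density of the second variation -/

section Polynomial

variable {F : Type*} [NormedAddCommGroup F] [InnerProductSpace ℝ F]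

/-- The second derivative at `s = 0` of the length of `x₀ + s x₁ + s² x₂ + s³ x₃`, provided that
`x₀` is a unit vector. -/
def secondDerivNorm (x : Fin 4 → F) : ℝ := ‖x 1‖ ^ 2 + 2 * ⟪x 0, x 2⟫ - ⟪x 0, x 1⟫ ^ 2

theorem hasSecondDerivAt_setIntegral_norm_sum_pow_smul {X : Type*} [TopologicalSpace X]
    [T2Space X] [MeasurableSpace X] [OpensMeasurableSpace X]
    {μ : Measure X} {K : Set X} {x : X → Fin 4 → F} (hK : IsCompact K) (hμ : μ K < ⊤)
    (hx : ∀ i, ContinuousOn (fun g => x g i) K) (hx0 : ∀ g ∈ K, ‖x g 0‖ = 1) :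
    HasSecondDerivAt (fun s => ∫ g in K, ‖∑ i : Fin 4, s ^ (i : ℕ) • x g i‖ ∂μ)
      (∫ g in K, secondDerivNorm (x g) ∂μ) 0 := by
  have hx' (i) : ContinuousOn (fun z : ℝ × X => x z.2 i) (univ ×ˢ K) :=
    (hx i).comp continuousOn_snd fun z hz => hz.2
  have hpow (i : ℕ) : ContinuousOn (fun z : ℝ × X => z.1 ^ i) (univ ×ˢ K) :=
    (continuous_fst.pow i).continuousOn
  have hder := hasSecondDerivAt_setIntegral_norm (x := 0) (μ := μ)
    (v := fun s g => ∑ i : Fin 4, s ^ (i : ℕ) • x g i)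
    (v' := fun s g => ∑ i : Fin 4, ((i : ℕ) * s ^ ((i : ℕ) - 1)) • x g i)
    (v'' := fun s g => ∑ i : Fin 4, ((i : ℕ) * (((i - 1 : ℕ) : ℝ) * s ^ ((i : ℕ) - 1 - 1))) • x g i)
    hK hμ (continuousOn_finsetSum _ fun i _ => (hpow i).smul (hx' i))
    (continuousOn_finsetSum _ fun i _ => (continuousOn_const.mul (hpow _)).smul (hx' i))
    (continuousOn_finsetSum _ fun i _ =>
      (continuousOn_const.mul (continuousOn_const.mul (hpow _))).smul (hx' i))
    (fun s g _ => .fun_sum fun i _ => (hasDerivAt_pow i s).smul_const (x g i))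
    (fun s g _ => .fun_sum fun i _ =>
      ((hasDerivAt_pow (i - 1 : ℕ) s).const_mul (i : ℝ)).smul_const (x g i))
    fun g hg => norm_ne_zero_iff.1 (by simp [Fin.sum_univ_four, hx0 g hg])
  convert hder using 1
  refine setIntegral_congr_fun hK.measurableSet fun g hg => ?_
  simp [secondDerivNorm, Fin.sum_univ_four, hx0 g hg, inner_smul_right]

end Polynomial

theorem norm_sq_sub_inner_sq {p q : ℝ} (hpq : p ^ 2 + q ^ 2 = 1) (x : EuclideanSpace ℝ (Fin 2)) :
    ‖x‖ ^ 2 - ⟪!₂[q, -p], x⟫ ^ 2 = (p * x 0 + q * x 1) ^ 2 := by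
  simp only [EuclideanSpace.norm_sq_eq, PiLp.inner_apply, Fin.sum_univ_two, Real.norm_eq_abs,
    sq_abs, Fin.isValue, Matrix.cons_val_one, Matrix.cons_val_zero, Matrix.cons_val_fin_one,
    RCLike.inner_apply, Real.ringHom_apply]
  linear_combination (-(x 0 ^ 2 + x 1 ^ 2)) * hpq

namespace OrientedSurface

variable {k : ℕ∞ω} {S : OrientedSurface k} {h a b : Heis → ℝ} {g : Heis}

/-- The value on `(Z, T - ω̄ Y)` of the exact form `d(h (a dx + b dy))`. -/
def exactTerm (S : OrientedSurface k) (h a b : Heis → ℝ) (g : Heis) : ℝ :=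
  S.bracket (fun x => h x * a x) (fun x => x.1) g
    + S.bracket (fun x => h x * b x) (fun x => x.2.1) g

section Tangential

variable (hk : 2 ≤ k) (hchar : S.charLocus = ∅)
include hk hchar

theorem IsNormalVariation.fderiv_fst (hab : S.IsNormalVariation h a b)
    (hh : DifferentiableAt ℝ h g) (hg : g ∈ S.carrier) {v : Heis} (hv : v ∈ S.tangent g) :
    fderiv ℝ a g v =
      h g * fderiv ℝ (pbar (S.normalNear g)) g v + pbar S.N g * fderiv ℝ h g v := by
  have hW : hlen (S.normalNear g g) ≠ 0 := normalNear_self hg ▸ hlen_ne_zero hchar hg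
  have hp := (contDiffAt_pbar (contDiffAt_normalNear hk hg) hW).differentiableAt one_ne_zero
  rw [fderiv_eq_of_eqOn (one_le_two.trans hk) (f₂ := fun x => h x * pbar (S.normalNear g) x) hg
    (eventually_normalNear_eq hg) (hab.contDiff_fst.differentiable one_ne_zero g) (hh.mul hp)
    (fun x hx => ?_) hv, fderiv_fun_mul hh hp]
  · simp [pbar_normalNear_self hg]
  · simp only [hab.fst_eq x hx.1, pbar, hx.2 hx.1]

theorem IsNormalVariation.fderiv_snd (hab : S.IsNormalVariation h a b)
    (hh : DifferentiableAt ℝ h g) (hg : g ∈ S.carrier) {v : Heis} (hv : v ∈ S.tangent g) :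
    fderiv ℝ b g v =
      h g * fderiv ℝ (qbar (S.normalNear g)) g v + qbar S.N g * fderiv ℝ h g v := by
  have hW : hlen (S.normalNear g g) ≠ 0 := normalNear_self hg ▸ hlen_ne_zero hchar hg
  have hq := (contDiffAt_qbar (contDiffAt_normalNear hk hg) hW).differentiableAt one_ne_zero
  rw [fderiv_eq_of_eqOn (one_le_two.trans hk) (f₂ := fun x => h x * qbar (S.normalNear g) x) hg
    (eventually_normalNear_eq hg) (hab.contDiff_snd.differentiable one_ne_zero g) (hh.mul hq)
    (fun x hx => ?_) hv, fderiv_fun_mul hh hq]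
  · simp [qbar_normalNear_self hg]
  · simp only [hab.snd_eq x hx.1, qbar, hx.2 hx.1]

theorem IsNormalVariation.normal_fderiv (hab : S.IsNormalVariation h a b)
    (hh : DifferentiableAt ℝ h g) (hg : g ∈ S.carrier) {v : Heis} (hv : v ∈ S.tangent g) :
    pbar S.N g * fderiv ℝ a g v + qbar S.N g * fderiv ℝ b g v = fderiv ℝ h g v := by
  have hW := hlen_ne_zero hchar hg
  have hunit := pbar_mul_fderiv_add_qbar_mul_fderiv (contDiffAt_normalNear hk hg)
    (normalNear_self hg ▸ hW) v
  rw [pbar_normalNear_self hg, qbar_normalNear_self hg] at hunit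
  rw [hab.fderiv_fst hk hchar hh hg hv, hab.fderiv_snd hk hchar hh hg hv]
  linear_combination h g * hunit + fderiv ℝ h g v * pbar_sq_add_qbar_sq hW

theorem IsNormalVariation.tangential_fderiv_tanT (hab : S.IsNormalVariation h a b)
    (hh : DifferentiableAt ℝ h g) (hg : g ∈ S.carrier) :
    pbar S.N g * fderiv ℝ b g (tanT S.N g) - qbar S.N g * fderiv ℝ a g (tanT S.N g) =
      h g * (S.calA g - ombar S.N g ^ 2) := by
  have hv := tanT_mem_tangent hg (hlen_ne_zero hchar hg)
  have hA := calA_sub_ombar_sq (S.normalNear g) g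
  rw [pbar_normalNear_self hg, qbar_normalNear_self hg, ombar_normalNear_self hg,
    tanT_normalNear_self hg] at hA
  rw [hab.fderiv_fst hk hchar hh hg hv, hab.fderiv_snd hk hchar hh hg hv, OrientedSurface.calA, hA]
  ring

theorem secondDerivNorm_normalCoeff (hab : S.IsNormalVariation h a b)
    (hh : DifferentiableAt ℝ h g) (hg : g ∈ S.carrier) :
    secondDerivNorm (S.normalCoeff h a b g) =
      (along (Z S.N) h g + h g * ombar S.N g) ^ 2 + h g ^ 2 * (S.calA g - ombar S.N g ^ 2) := by
  have hpq := pbar_sq_add_qbar_sq (hlen_ne_zero hchar hg)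
  have hnormal : pbar S.N g * S.normalCoeff h a b g 1 0 + qbar S.N g * S.normalCoeff h a b g 1 1 =
      along (Z S.N) h g + h g * ombar S.N g := by
    rw [along, ← hab.normal_fderiv hk hchar hh hg (Z_mem_tangent hg)]
    simp only [normalCoeff, Fin.isValue, Matrix.cons_val_one, Matrix.cons_val_zero,
      Matrix.cons_val_fin_one, PiLp.add_apply, PiLp.smul_apply, smul_eq_mul]
    linear_combination h g * ombar S.N g * hpq
  have htangential : 2 * ⟪S.normalCoeff h a b g 0, S.normalCoeff h a b g 2⟫ =
      h g ^ 2 * (S.calA g - ombar S.N g ^ 2) := by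
    have hT := hab.tangential_fderiv_tanT hk hchar hh hg
    simp only [normalCoeff, hab.fst_eq g hg, hab.snd_eq g hg, PiLp.inner_apply, Fin.sum_univ_two,
      Fin.isValue, Matrix.cons_val_one, Matrix.cons_val_zero, Matrix.cons_val_fin_one,
      Matrix.cons_val, PiLp.add_apply, PiLp.sub_apply, PiLp.smul_apply, smul_eq_mul,
      RCLike.inner_apply, Real.ringHom_apply]
    linear_combination h g * hT - h g * (pbar S.N g * fderiv ℝ b g (tanT S.N g)
      - qbar S.N g * fderiv ℝ a g (tanT S.N g)) * hpq
  have hpythagoras := norm_sq_sub_inner_sq hpq (S.normalCoeff h a b g 1)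
  rw [hnormal] at hpythagoras
  rw [secondDerivNorm, ← hpythagoras, ← htangential]
  change _ = ‖_‖ ^ 2 - ⟪S.normalCoeff h a b g 0, _⟫ ^ 2 + _
  ring

theorem exactTerm_eq (hab : S.IsNormalVariation h a b) (hh : DifferentiableAt ℝ h g)
    (hg : g ∈ S.carrier) :
    S.exactTerm h a b g = h g ^ 2 * (S.calA g - ombar S.N g ^ 2)
      - 2 * h g * ombar S.N g * along (Z S.N) h g := by
  have hpq := pbar_sq_add_qbar_sq (hlen_ne_zero hchar hg)
  have hnormal := hab.normal_fderiv hk hchar hh hg (Z_mem_tangent hg)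
  have htangential := hab.tangential_fderiv_tanT hk hchar hh hg
  have hda := hab.contDiff_fst.differentiable one_ne_zero g
  have hdb := hab.contDiff_snd.differentiable one_ne_zero g
  have hx : fderiv ℝ (fun x : Heis => x.1) g = .fst ℝ ℝ (ℝ × ℝ) := fderiv_fst
  have hy : fderiv ℝ (fun x : Heis => x.2.1) g =
      (ContinuousLinearMap.fst ℝ ℝ ℝ).comp (.snd ℝ ℝ (ℝ × ℝ)) := hasFDerivAt_snd.fst.fderiv
  simp only [exactTerm, bracket, hx, hy, fderiv_fun_mul hh hda, fderiv_fun_mul hh hdb, along,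
    add_apply, smul_apply, smul_eq_mul, ContinuousLinearMap.coe_fst',
    ContinuousLinearMap.comp_apply, ContinuousLinearMap.coe_snd', Z_fst, Z_snd_fst, tanT_fst,
    tanT_snd_fst, hab.fst_eq g hg, hab.snd_eq g hg]
  linear_combination h g * htangential - ombar S.N g * h g * hnormal
    - ombar S.N g * h g * fderiv ℝ h g (Z S.N g) * hpq

theorem integrand_eq_secondDerivNorm_add_exactTerm (hab : S.IsNormalVariation h a b)
    (hh : DifferentiableAt ℝ h g) (hg : g ∈ S.carrier) :
    S.integrand h g = secondDerivNorm (S.normalCoeff h a b g) + S.exactTerm h a b g := by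
  rw [secondDerivNorm_normalCoeff hk hchar hab hh hg, exactTerm_eq hk hchar hab hh hg, integrand]
  ring

end Tangential

end OrientedSurface

/-! ### The second variation of the `H`-perimeter -/

namespace OrientedSurface

variable {k : ℕ∞ω} {S : OrientedSurface k} {h a b : Heis → ℝ} {g : Heis} {K E : Set Heis}

theorem IsNormalVariation.deform_eq (hab : S.IsNormalVariation h a b) (s : ℝ) :
    EqOn (S.deform h s) (fun g => g + s • horizontalField a b g) S.carrier := by
  intro g hg
  simp only [deform, horizontalField, Y, hab.fst_eq g hg, hab.snd_eq g hg]
  module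

section FirstOrder

variable (hk : 1 ≤ k) (hchar : S.charLocus = ∅)
include hk hchar

theorem continuousOn_deformedNormal (hh : ContinuousOn h S.carrier)
    (hab : S.IsNormalVariation h a b) :
    ContinuousOn (fun z : ℝ × Heis => S.deformedNormal h a b z.1 z.2) (univ ×ˢ S.carrier) :=
  continuousOn_finsetSum _ fun i _ => (continuous_fst.pow _).continuousOn.smul <|
    (continuousOn_normalCoeff hk hchar hh hab.contDiff_fst hab.contDiff_snd i).comp
      continuousOn_snd fun _ hz => hz.2

theorem eventually_deformedNormal_ne_zero (hh : ContinuousOn h S.carrier)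
    (hab : S.IsNormalVariation h a b) (hK : IsCompact K) (hKS : K ⊆ S.carrier)
    (hsupp : ∀ g ∈ S.carrier \ K, h g = 0) :
    ∀ᶠ s in 𝓝 (0 : ℝ), ∀ g ∈ S.carrier, S.deformedNormal h a b s g ≠ 0 := by
  obtain ⟨I, -, hI, hne⟩ := exists_isCompact_nhds_forall_ne_zero (x := 0) hK
    ((continuousOn_deformedNormal hk hchar hh hab).mono (prod_mono_right hKS)) fun g hg =>
      norm_ne_zero_iff.1 (by simp [deformedNormal, Fin.sum_univ_four,
        norm_normalCoeff_zero hchar (hKS hg)])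
  filter_upwards [hI] with s hs g hg
  by_cases hgK : g ∈ K
  · exact hne s hs g hgK
  · exact norm_ne_zero_iff.1 (by
      simp [norm_deformedNormal_of_notMem hk hchar hab hK.isClosed hsupp s ⟨hg, hgK⟩])

open Classical in
theorem isHJacobian_norm_deformedNormal (hh : ContinuousOn h S.carrier)
    (hab : S.IsNormalVariation h a b) {s : ℝ}
    (hne : ∀ g ∈ S.carrier, S.deformedNormal h a b s g ≠ 0) {e : Heis ≃ₜ Heis}
    (hes : ∀ g, e g = g + s • horizontalField a b g) (he : ContDiff ℝ 1 e)
    (he' : ContDiff ℝ 1 e.symm) :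
    IsHJacobian S.carrier e he he'
      (S.carrier.piecewise (fun g => ENNReal.ofReal ‖S.deformedNormal h a b s g‖) 1) where
  measurable := ContinuousOn.measurable_piecewise
    (ENNReal.continuous_ofReal.comp_continuousOn ((continuousOn_deformedNormal hk hchar hh hab).comp
      (continuousOn_const.prodMk continuousOn_id) fun _ hg => ⟨mem_univ s, hg⟩).norm)
    continuousOn_const S.measurableSet_carrier
  ne_zero g := by
    by_cases hg : g ∈ S.carrier
    · simpa [hg] using hne g hg
    · simp [hg]
  ne_top g := by by_cases hg : g ∈ S.carrier <;> simp [hg]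
  hlen_normal_push c u hu := by
    rw [hlen_normal_push hk hchar hab hes he he' (mapsTo_image e S.carrier) c hu,
      piecewise_eq_of_mem _ _ _ (c.mapsTo hu), mul_comm, ENNReal.ofReal_mul (norm_nonneg _),
      mul_comm]

theorem eventually_deformedPerimeter_eq_lintegral (hh : ContinuousOn h S.carrier)
    (hab : S.IsNormalVariation h a b) (hK : IsCompact K) (hKS : K ⊆ S.carrier)
    (hsupp : ∀ g ∈ S.carrier \ K, h g = 0) (hE : MeasurableSet E) (hES : E ⊆ S.carrier) :
    ∀ᶠ s in 𝓝 (0 : ℝ), S.deformedPerimeter h E s =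
      ∫⁻ g in E, ENNReal.ofReal ‖S.deformedNormal h a b s g‖ ∂hPerimeter S.carrier := by
  classical
  filter_upwards [eventually_deformedNormal_ne_zero hk hchar hh hab hK hKS hsupp,
    eventually_exists_homeomorph_add_smul one_ne_zero
      (contDiff_horizontalField hab.contDiff_fst hab.contDiff_snd)
      (hasCompactSupport_horizontalField hab.hasCompactSupport_fst hab.hasCompactSupport_snd)]
    with s hne ⟨e, hes, he'⟩
  have he : ContDiff ℝ 1 e := by
    rw [funext hes]
    exact contDiff_id.add
      ((contDiff_horizontalField hab.contDiff_fst hab.contDiff_snd).const_smul s)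
  have hdeform : EqOn (S.deform h s) e S.carrier := funext hes ▸ hab.deform_eq s
  rw [deformedPerimeter, hdeform.image_eq, (hdeform.mono hES).image_eq,
    (isHJacobian_norm_deformedNormal hk hchar hh hab hne hes he he').hPerimeter_image hE]
  exact setLIntegral_congr_fun hE fun g hg => piecewise_eq_of_mem _ _ _ (hES hg)

theorem eventually_deformedPerimeter_eq (hh : ContinuousOn h S.carrier)
    (hab : S.IsNormalVariation h a b) (hK : IsCompact K) (hsupp : ∀ g ∈ S.carrier \ K, h g = 0)
    (hE : MeasurableSet E) (hES : E ⊆ S.carrier) (hKE : K ⊆ E)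
    (hfin : hPerimeter S.carrier K < ⊤) :
    ∀ᶠ s in 𝓝 (0 : ℝ), S.deformedPerimeter h E s = hPerimeter S.carrier (E \ K) +
      ENNReal.ofReal (∫ g in K, ‖S.deformedNormal h a b s g‖ ∂hPerimeter S.carrier) := by
  have hKS := hKE.trans hES
  filter_upwards [eventually_deformedPerimeter_eq_lintegral hk hchar hh hab hK hKS hsupp hE hES]
    with s hs
  have hcont : ContinuousOn (fun g => ‖S.deformedNormal h a b s g‖) K :=
    ((continuousOn_deformedNormal hk hchar hh hab).comp
      (continuousOn_const.prodMk continuousOn_id) fun _ hg => ⟨mem_univ s, hKS hg⟩).norm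
  have hinteg : IntegrableOn (fun g => ‖S.deformedNormal h a b s g‖) K (hPerimeter S.carrier) :=
    hcont.integrableOn_of_subset_isCompact hK hK.measurableSet subset_rfl hfin.ne
  have houter : ∫⁻ g in E \ K, ENNReal.ofReal ‖S.deformedNormal h a b s g‖ ∂hPerimeter S.carrier =
      hPerimeter S.carrier (E \ K) := by
    rw [setLIntegral_congr_fun (hE.diff hK.measurableSet) (g := fun _ => 1) fun g hg => by
      simp [norm_deformedNormal_of_notMem hk hchar hab hK.isClosed hsupp s ⟨hES hg.1, hg.2⟩],
      setLIntegral_one]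
  rw [hs, ofReal_integral_eq_lintegral_ofReal hinteg (.of_forall fun g => norm_nonneg _), ← houter,
    ← lintegral_union hK.measurableSet disjoint_sdiff_left, sdiff_union_of_subset hKE]

end FirstOrder

theorem hasSecondDerivAt_integral_norm_deformedNormal (hk : 1 ≤ k) (hchar : S.charLocus = ∅)
    (hh : ContinuousOn h S.carrier) (hab : S.IsNormalVariation h a b) (hK : IsCompact K)
    (hKS : K ⊆ S.carrier) (hfin : hPerimeter S.carrier K < ⊤) :
    HasSecondDerivAt
      (fun s => ∫ g in K, ‖S.deformedNormal h a b s g‖ ∂hPerimeter S.carrier)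
      (∫ g in K, secondDerivNorm (S.normalCoeff h a b g) ∂hPerimeter S.carrier) 0 :=
  hasSecondDerivAt_setIntegral_norm_sum_pow_smul hK hfin
    (fun i => (continuousOn_normalCoeff hk hchar hh hab.contDiff_fst hab.contDiff_snd i).mono hKS)
    fun _ hg => norm_normalCoeff_zero hchar (hKS hg)

section SecondOrder

variable (hk : 2 ≤ k) (hchar : S.charLocus = ∅) (hh : ContDiff ℝ 1 h)
  (hab : S.IsNormalVariation h a b) (hK : IsCompact K) (hKS : K ⊆ S.carrier)
  (hsupp : ∀ g ∈ S.carrier \ K, h g = 0) (hfin : hPerimeter S.carrier K < ⊤)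
include hk hchar hh hab hK hsupp

theorem secondDerivNorm_normalCoeff_eq_zero_of_notMem (hg : g ∈ S.carrier \ K) :
    secondDerivNorm (S.normalCoeff h a b g) = 0 := by
  have hhd := hh.differentiable one_ne_zero g
  rw [secondDerivNorm_normalCoeff hk hchar hab hhd hg.1, along,
    fderiv_eq_zero_of_mem_tangent (one_le_two.trans hk) hK.isClosed hhd hsupp hg
      (Z_mem_tangent hg.1), hsupp g hg]
  simp

include hKS hfin

theorem integrableOn_secondDerivNorm_normalCoeff :
    IntegrableOn (fun g => secondDerivNorm (S.normalCoeff h a b g)) S.carrier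
      (hPerimeter S.carrier) := by
  have hx := continuousOn_normalCoeff (one_le_two.trans hk) hchar
    hh.continuous.continuousOn hab.contDiff_fst hab.contDiff_snd
  refine integrableOn_of_continuousOn hK hfin (ContinuousOn.mono ?_ hKS) fun g hg =>
    secondDerivNorm_normalCoeff_eq_zero_of_notMem hk hchar hh hab hK hsupp hg
  exact (((hx 1).norm.pow 2).add (continuousOn_const.mul ((hx 0).inner (hx 2)))).sub
    (((hx 0).inner (hx 1)).pow 2)

theorem integrableOn_exactTerm :
    IntegrableOn (S.exactTerm h a b) S.carrier (hPerimeter S.carrier) := by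
  have hbracket {f B : Heis → ℝ} (hf : ContDiff ℝ 1 f) (hB : ContDiff ℝ 1 B) :
      IntegrableOn (S.bracket (fun x => h x * f x) B) S.carrier (hPerimeter S.carrier) :=
    integrableOn_bracket (one_le_two.trans hk) hchar hK hKS hfin (hh.mul hf)
      (fun x hx => by rw [hsupp x hx, zero_mul]) hB
  exact (hbracket hab.contDiff_fst contDiff_fst).add
    (hbracket hab.contDiff_snd contDiff_snd.fst)

theorem integral_exactTerm_eq_zero :
    ∫ g in S.carrier, S.exactTerm h a b g ∂hPerimeter S.carrier = 0 := by
  have hsupp' (f : Heis → ℝ) : ∀ g ∈ S.carrier \ K, h g * f g = 0 := fun g hg => by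
    rw [hsupp g hg, zero_mul]
  have hha := hh.mul hab.contDiff_fst
  have hhb := hh.mul hab.contDiff_snd
  have hk1 : 1 ≤ k := one_le_two.trans hk
  simp only [exactTerm]
  rw [integral_add (integrableOn_bracket hk1 hchar hK hKS hfin hha (hsupp' a) contDiff_fst)
      (integrableOn_bracket hk1 hchar hK hKS hfin hhb (hsupp' b) contDiff_snd.fst),
    integral_bracket_eq_zero hchar hk hK hKS hfin hha (hsupp' a) contDiff_fst,
    integral_bracket_eq_zero hchar hk hK hKS hfin hhb (hsupp' b) contDiff_snd.fst, add_zero]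

theorem integrableOn_integrand :
    IntegrableOn (S.integrand h) S.carrier (hPerimeter S.carrier) :=
  ((integrableOn_secondDerivNorm_normalCoeff hk hchar hh hab hK hKS hsupp hfin).add
    (integrableOn_exactTerm hk hchar hh hab hK hKS hsupp hfin)).congr_fun
    (fun g hg => (integrand_eq_secondDerivNorm_add_exactTerm hk hchar hab
      (hh.differentiable one_ne_zero g) hg).symm) S.measurableSet_carrier

theorem integral_integrand :
    ∫ g in S.carrier, S.integrand h g ∂hPerimeter S.carrier =
      ∫ g in K, secondDerivNorm (S.normalCoeff h a b g) ∂hPerimeter S.carrier := by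
  rw [setIntegral_congr_fun S.measurableSet_carrier fun g hg =>
      integrand_eq_secondDerivNorm_add_exactTerm hk hchar hab
        (hh.differentiable one_ne_zero g) hg,
    integral_add (integrableOn_secondDerivNorm_normalCoeff hk hchar hh hab hK hKS hsupp hfin)
      (integrableOn_exactTerm hk hchar hh hab hK hKS hsupp hfin),
    integral_exactTerm_eq_zero hk hchar hh hab hK hKS hsupp hfin, add_zero]
  exact setIntegral_eq_of_subset_of_forall_sdiff_eq_zero S.measurableSet_carrier hKS fun g hg =>
    secondDerivNorm_normalCoeff_eq_zero_of_notMem hk hchar hh hab hK hsupp hg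

end SecondOrder

end OrientedSurface

end Heis

end

open Heis OrientedSurface in
theorem lemma3p8_general {k : WithTop ℕ∞} (hk : 2 ≤ k) (S : Heis.OrientedSurface k)
    (hchar : S.charLocus = ∅) (h : Heis → ℝ) (hh : ContDiff ℝ 1 h)
    (K : Set Heis) (hK : IsCompact K) (hKS : K ⊆ S.carrier)
    (hsupp : ∀ g ∈ S.carrier \ K, h g = 0)
    (E : Set Heis) (hE : MeasurableSet E) (hES : E ⊆ S.carrier) (hKE : K ⊆ E)
    (hfin : Heis.hPerimeter S.carrier E < ⊤) :
    (∀ᶠ s in 𝓝 (0 : ℝ), S.deformedPerimeter h E s < ⊤) ∧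
    IntegrableOn (S.integrand h) S.carrier (Heis.hPerimeter S.carrier) ∧
    Heis.HasSecondDerivAt (fun s => (S.deformedPerimeter h E s).toReal)
      (∫ g in S.carrier, S.integrand h g ∂(Heis.hPerimeter S.carrier)) 0 ∧
    ∫ g in S.carrier, S.integrand h g ∂(Heis.hPerimeter S.carrier) =
      ∫ g in S.carrier, S.integrand' h g ∂(Heis.hPerimeter S.carrier) := by
  obtain ⟨a, b, hab⟩ := exists_isNormalVariation hk hchar hh hK hKS hsupp
  have hfinK : hPerimeter S.carrier K < ⊤ := (measure_mono hKE).trans_lt hfin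
  have hfinEK : hPerimeter S.carrier (E \ K) < ⊤ := (measure_mono sdiff_subset).trans_lt hfin
  have hperimeter := eventually_deformedPerimeter_eq (one_le_two.trans hk) hchar
    hh.continuous.continuousOn hab hK hsupp hE hES hKE hfinK
  refine ⟨?_, integrableOn_integrand hk hchar hh hab hK hKS hsupp hfinK, ?_,
    setIntegral_congr_fun S.measurableSet_carrier fun g hg => integrand_eq_integrand' hg⟩
  · filter_upwards [hperimeter] with s hs
    exact hs ▸ ENNReal.add_lt_top.2 ⟨hfinEK, ENNReal.ofReal_lt_top⟩
  · rw [integral_integrand hk hchar hh hab hK hKS hsupp hfinK]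
    refine (hasSecondDerivAt_integral_norm_deformedNormal (one_le_two.trans hk) hchar
      hh.continuous.continuousOn hab hK hKS hfinK).const_add_congr
      (hPerimeter S.carrier (E \ K)).toReal ?_
    filter_upwards [hperimeter] with s hs
    rw [hs, ENNReal.toReal_add hfinEK.ne ENNReal.ofReal_ne_top,
      ENNReal.toReal_ofReal (integral_nonneg fun _ => norm_nonneg _)]

theorem lemma3p8 (S : Heis.OrientedSurface 3) (hchar : S.charLocus = ∅)
    -- a function on `S` of class `C²`, given by an extension to `ℝ³`, ...
    (h : Heis → ℝ) (hh : ContDiff ℝ 2 h)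
    -- ... whose restriction to `S` is supported in a compact subset `K` of `S`
    (K : Set Heis) (hK : IsCompact K) (hKS : K ⊆ S.carrier)
    (hsupp : ∀ g ∈ S.carrier \ K, h g = 0)
    -- a Borel part `E` of `S` of finite `H`-perimeter that contains the support
    -- (all of `S`, if `S` has finite `H`-perimeter)
    (E : Set Heis) (hE : MeasurableSet E) (hES : E ⊆ S.carrier) (hKE : K ⊆ E)
    (hfin : Heis.hPerimeter S.carrier E < ⊤) :
    (∀ᶠ s in 𝓝 (0 : ℝ), S.deformedPerimeter h E s < ⊤) ∧
    IntegrableOn (S.integrand h) S.carrier (Heis.hPerimeter S.carrier) ∧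
    Heis.HasSecondDerivAt (fun s => (S.deformedPerimeter h E s).toReal)
      (∫ g in S.carrier, S.integrand h g ∂(Heis.hPerimeter S.carrier)) 0 ∧
    ∫ g in S.carrier, S.integrand h g ∂(Heis.hPerimeter S.carrier) =
      ∫ g in S.carrier, S.integrand' h g ∂(Heis.hPerimeter S.carrier) :=
  lemma3p8_general (by norm_num) S hchar h (hh.of_le one_le_two) K hK hKS hsupp E hE hES hKE hfin
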